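/- Let $(M,g)$ be a closed (compact, without boundary) Kähler manifold of complex dimension $2$. In local holomorphic coordinates $(z^1,z^2)$ write $g_{i\bar j}=g(\partial_{z^i},\partial_{\bar z^j})$ and $u_{i\bar j}=\partial^2u/\partial z^i\partial\bar z^j$, and let $\Delta u=g^{i\bar j}u_{i\bar j}$ be the complex Laplacian. Then for all $A, B, S\in\mathbb{R}$ and $L\ge 0$ there is a constant $C$, depending only on $(M,g)$, $A$, $B$, $S$ and $L$, such that the following holds. Let $f:M\to\mathbb{R}$ be a positive function and let $\phi\in C^4(M)$ be a real-valued solution of the Monge--Ampère equation $$\det(g_{i\bar j}+\phi_{i\bar j})=f\,\det(g_{i\bar j})$$ on $M$ such that $(g_{i\bar j}+\phi_{i\bar j})$ is positive definite (in particular $f$ is of class $C^2$). If $\inf_M\Delta f\ge -A$, $f^{1/2}$ is Lipschitz with constant $L$ for the Riemannian distance of $g$, $\sup_M f\le S$, and $\sup_M\phi-\inf_M\phi\le B$, then $$|\Delta\phi|\le C\quad\text{on } M.$$ -/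

import Mathlib

open scoped Manifold ContDiff Bundle ComplexOrder NNReal ENNReal

noncomputable section

namespace KahlerSurface

/-- The model space `ℂ²`. -/
abbrev C2 : Type := EuclideanSpace ℂ (Fin 2)

/-- The coordinate vector `∂/∂xⁱ` of `ℂ² = ℝ⁴`, where `zⁱ = xⁱ + √-1 yⁱ`. -/
def dx (i : Fin 2) : C2 := EuclideanSpace.single i 1

/-- The coordinate vector `∂/∂yⁱ` of `ℂ² = ℝ⁴`, where `zⁱ = xⁱ + √-1 yⁱ`. -/
def dy (i : Fin 2) : C2 := EuclideanSpace.single i Complex.I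

/-- The Wirtinger derivative `∂F/∂zⁱ = (1/2) (∂F/∂xⁱ - √-1 ∂F/∂yⁱ)`. -/
def wirtinger (i : Fin 2) (F : C2 → ℂ) (z : C2) : ℂ :=
  (1 / 2) * (fderiv ℝ F z (dx i) - Complex.I * fderiv ℝ F z (dy i))

/-- The Wirtinger derivative `∂F/∂z̄ⁱ = (1/2) (∂F/∂xⁱ + √-1 ∂F/∂yⁱ)`. -/
def wirtingerBar (i : Fin 2) (F : C2 → ℂ) (z : C2) : ℂ :=
  (1 / 2) * (fderiv ℝ F z (dx i) + Complex.I * fderiv ℝ F z (dy i))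

/-- The matrix `(u_{i j̄}) = (∂²u / ∂zⁱ ∂z̄ʲ)` of a real function `u` on `ℂ²`. -/
def complexHessian (u : C2 → ℝ) (z : C2) : Matrix (Fin 2) (Fin 2) ℂ :=
  Matrix.of fun i j => wirtinger i (wirtingerBar j fun w => (u w : ℂ)) z

section Manifold

variable (M : Type*) [TopologicalSpace M] [ChartedSpace C2 M]

/-- A complex surface is in particular a smooth real four-manifold. -/
instance isManifold_real [IsManifold 𝓘(ℂ, C2) ω M] : IsManifold 𝓘(ℝ, C2) ∞ M := by
  refine isManifold_of_contDiffOn 𝓘(ℝ, C2) ∞ M fun e e' he he' => ?_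
  have h := (contDiffGroupoid ω 𝓘(ℂ, C2)).compatible he he'
  rw [contDiffGroupoid, mem_groupoid_of_pregroupoid] at h
  have h1 : ContDiffOn ℂ ω _ _ := h.1
  exact (h1.of_le le_top).restrict_scalars ℝ

variable {M}

/-- The complex structure `J` on the tangent spaces. The tangent space at `p` is identified with
`ℂ²` through the holomorphic chart `chartAt C2 p`. -/
def tangentJ (p : M) (v : TangentSpace 𝓘(ℝ, C2) p) : TangentSpace 𝓘(ℝ, C2) p :=
  (Complex.I • (show C2 from v) : C2)

/-- The real tangent vector on `M` that has the constant coordinates `v` in the chart `e`, at the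
point with coordinates `z`. -/
def coordVector (e : OpenPartialHomeomorph M C2) (z : C2) (v : C2) :
    TangentSpace 𝓘(ℝ, C2) (e.symm z) :=
  mfderiv 𝓘(ℝ, C2) 𝓘(ℝ, C2) e.symm z v

/-- Given a field `G` of real bilinear forms on the tangent spaces, the matrix
`G_{i j̄} = G(∂/∂zⁱ, ∂/∂z̄ʲ)` of its complex bilinear extension in the coordinates `e`, at the
point with coordinates `z`; here `∂/∂zⁱ = (1/2) (∂/∂xⁱ - √-1 ∂/∂yⁱ)` and
`∂/∂z̄ʲ = (1/2) (∂/∂xʲ + √-1 ∂/∂yʲ)`. -/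
def coordMatrix
    (G : ∀ p : M, TangentSpace 𝓘(ℝ, C2) p →L[ℝ] TangentSpace 𝓘(ℝ, C2) p →L[ℝ] ℝ)
    (e : OpenPartialHomeomorph M C2) (z : C2) : Matrix (Fin 2) (Fin 2) ℂ :=
  Matrix.of fun i j =>
    (1 / 4) *
      (((G (e.symm z) (coordVector e z (dx i)) (coordVector e z (dx j)) : ℝ) : ℂ)
        + ((G (e.symm z) (coordVector e z (dy i)) (coordVector e z (dy j)) : ℝ) : ℂ)
        + Complex.I *
          (((G (e.symm z) (coordVector e z (dx i)) (coordVector e z (dy j)) : ℝ) : ℂ)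
            - ((G (e.symm z) (coordVector e z (dy i)) (coordVector e z (dx j)) : ℝ) : ℂ)))

end Manifold

/-- A Kähler metric on a complex surface: a smooth Riemannian metric `g` that is `J`-invariant and
whose fundamental form is closed, i.e. `∂_k g_{i j̄} = ∂_i g_{k j̄}` in all holomorphic
coordinates. -/
structure KahlerMetric (M : Type*) [TopologicalSpace M] [ChartedSpace C2 M]
    [IsManifold 𝓘(ℂ, C2) ω M] extends
    Bundle.ContMDiffRiemannianMetric 𝓘(ℝ, C2) ∞ C2
      (fun p : M => TangentSpace 𝓘(ℝ, C2) p) where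
  hermitian : ∀ (p : M) (v w : TangentSpace 𝓘(ℝ, C2) p),
    inner p (tangentJ p v) (tangentJ p w) = inner p v w
  closed : ∀ e ∈ IsManifold.maximalAtlas 𝓘(ℂ, C2) ω M, ∀ z ∈ e.target, ∀ i j k : Fin 2,
    wirtinger k (fun w => coordMatrix inner e w i j) z
      = wirtinger i (fun w => coordMatrix inner e w k j) z

namespace KahlerMetric

variable {M : Type*} [TopologicalSpace M] [ChartedSpace C2 M] [IsManifold 𝓘(ℂ, C2) ω M]

/-- The matrix `(g_{i j̄})` at `p` in the coordinates `e`. -/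
def matrix (g : KahlerMetric M) (e : OpenPartialHomeomorph M C2) (p : M) :
    Matrix (Fin 2) (Fin 2) ℂ :=
  coordMatrix g.inner e (e p)

/-- The Riemannian distance of `g`: the infimum of the `g`-lengths of `C¹` paths. -/
def rdist (g : KahlerMetric M) (p q : M) : ℝ≥0∞ :=
  letI : Bundle.RiemannianBundle (fun p : M => TangentSpace 𝓘(ℝ, C2) p) :=
    ⟨g.toContMDiffRiemannianMetric.toRiemannianMetric⟩
  Manifold.riemannianEDist 𝓘(ℝ, C2) p q

/-- `h` is Lipschitz with constant `L` for the Riemannian distance of `g`. -/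
def IsLipschitz (g : KahlerMetric M) (L : ℝ≥0) (h : M → ℝ) : Prop :=
  ∀ p q : M, edist (h p) (h q) ≤ L * g.rdist p q

end KahlerMetric

section Functions

variable {M : Type*} [TopologicalSpace M] [ChartedSpace C2 M]

/-- The matrix `(u_{i j̄})` of a function `u` on `M` at `p` in the coordinates `e`. -/
def hessianMatrix (u : M → ℝ) (e : OpenPartialHomeomorph M C2) (p : M) :
    Matrix (Fin 2) (Fin 2) ℂ :=
  complexHessian (u ∘ e.symm) (e p)

variable [IsManifold 𝓘(ℂ, C2) ω M]

/-- The complex Laplacian `Δu = g^{i j̄} u_{i j̄}`. For a `C²` function `u` the trace is real and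
does not depend on the holomorphic coordinates; it is evaluated at `p` in the chart at `p`. -/
def KahlerMetric.laplacian (g : KahlerMetric M) (u : M → ℝ) (p : M) : ℝ :=
  (Matrix.trace ((g.matrix (chartAt C2 p) p)⁻¹ * hessianMatrix u (chartAt C2 p) p)).re

/-- `φ` solves `det (g_{i j̄} + φ_{i j̄}) = f det (g_{i j̄})` in all holomorphic coordinates. -/
def KahlerMetric.SolvesMongeAmpere (g : KahlerMetric M) (f φ : M → ℝ) : Prop :=
  ∀ e ∈ IsManifold.maximalAtlas 𝓘(ℂ, C2) ω M, ∀ p ∈ e.source,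
    (g.matrix e p + hessianMatrix φ e p).det = (f p : ℂ) * (g.matrix e p).det

/-- `(g_{i j̄} + φ_{i j̄})` is positive definite in all holomorphic coordinates. -/
def KahlerMetric.IsAdmissible (g : KahlerMetric M) (φ : M → ℝ) : Prop :=
  ∀ e ∈ IsManifold.maximalAtlas 𝓘(ℂ, C2) ω M, ∀ p ∈ e.source,
    (g.matrix e p + hessianMatrix φ e p).PosDef

end Functions

end KahlerSurface

end

open KahlerSurface

/-! Fix `λ` larger than a curvature bound of `g` and apply the maximum principle to
`log (2 + Δφ) - λφ`. At a maximum, choose holomorphic coordinates in which `g` is the identity and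
`g + φ_{ij̄}` is diagonal, and differentiate the Monge--Ampère equation twice with the Chern
connection of `g`. The fourth-order terms then cancel up to curvature. In complex dimension two
the quadratic gradient terms coming from the logarithm are absorbed by the cubic derivatives of
`φ` up to a multiple of `|∇f|² / f = 4 |∇√f|²`, which is bounded because `√f` is Lipschitz. What
remains is a quadratic inequality for `2 + Δφ` at the maximum, and the oscillation bound for `φ`
carries the resulting estimate to every other point. -/

noncomputable section

namespace KahlerSurface

open Filter Topology ComplexConjugate

section RealCalculus

variable {E : Type*} [NormedAddCommGroup E] [NormedSpace ℝ E] {z : E}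

lemma fderiv_conj_apply (F : E → ℂ) (z v : E) :
    fderiv ℝ (fun w => conj (F w)) z v = conj (fderiv ℝ F z v) :=
  DFunLike.congr_fun (fderiv_star (f := F)) v

lemma fderiv_ofReal_apply {u : E → ℝ} (hu : DifferentiableAt ℝ u z) (v : E) :
    fderiv ℝ (fun w => (u w : ℂ)) z v = fderiv ℝ u z v :=
  DFunLike.congr_fun (Complex.ofRealCLM.hasFDerivAt.comp z hu.hasFDerivAt).fderiv v

lemma contDiffAt_ofReal {n : ℕ∞ω} {u : E → ℝ} (hu : ContDiffAt ℝ n u z) :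
    ContDiffAt ℝ n (fun w => (u w : ℂ)) z :=
  Complex.ofRealCLM.contDiff.contDiffAt.comp z hu

variable {V : Type*} [NormedAddCommGroup V] [NormedSpace ℝ V] {F : E → V}

lemma contDiffAt_fderiv_apply {m n : ℕ∞ω} (hF : ContDiffAt ℝ n F z) (hmn : m + 1 ≤ n) (v : E) :
    ContDiffAt ℝ m (fun w => fderiv ℝ F w v) z :=
  (hF.fderiv_right hmn).clm_apply contDiffAt_const

lemma differentiableAt_fderiv_apply (hF : ContDiffAt ℝ 2 F z) (v : E) :
    DifferentiableAt ℝ (fun w => fderiv ℝ F w v) z :=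
  (contDiffAt_fderiv_apply (m := 1) hF (by norm_num) v).differentiableAt one_ne_zero

lemma fderiv_fderiv_apply (hF : ContDiffAt ℝ 2 F z) (v w : E) :
    fderiv ℝ (fun x => fderiv ℝ F x v) z w = fderiv ℝ (fderiv ℝ F) z w v := by
  have hdF : DifferentiableAt ℝ (fderiv ℝ F) z :=
    (hF.fderiv_right (m := 1) (by norm_num)).differentiableAt one_ne_zero
  simp [fderiv_clm_apply hdF (differentiableAt_const v)]

lemma fderiv_fderiv_apply_comm (hF : ContDiffAt ℝ 2 F z) (v w : E) :
    fderiv ℝ (fun x => fderiv ℝ F x v) z w = fderiv ℝ (fun x => fderiv ℝ F x w) z v := by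
  rw [fderiv_fderiv_apply hF, fderiv_fderiv_apply hF]
  exact (hF.isSymmSndFDerivAt (by simp)) w v

lemma fderiv_fderiv_ofReal_apply {u : E → ℝ} (hu : ContDiffAt ℝ 2 u z) (v w : E) :
    fderiv ℝ (fun x => fderiv ℝ (fun y => (u y : ℂ)) x v) z w
      = fderiv ℝ (fun x => fderiv ℝ u x v) z w := by
  have hev : (fun x => fderiv ℝ (fun y => (u y : ℂ)) x v) =ᶠ[𝓝 z]
      fun x => (fderiv ℝ u x v : ℂ) := by
    filter_upwards [hu.eventually (by simp)] with x hx
    exact fderiv_ofReal_apply (hx.differentiableAt two_ne_zero) v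
  rw [hev.fderiv_eq, fderiv_ofReal_apply (differentiableAt_fderiv_apply hu v)]

lemma hasDerivAt_add_smul (z v : E) (t : ℝ) : HasDerivAt (fun s : ℝ => z + s • v) v t := by
  simpa using ((hasDerivAt_id t).smul_const v).const_add z

lemma deriv_deriv_comp_add_smul (hF : ContDiffAt ℝ 2 F z) (v : E) :
    deriv (deriv fun t : ℝ => F (z + t • v)) 0 = fderiv ℝ (fun w => fderiv ℝ F w v) z v := by
  have hline : Tendsto (fun t : ℝ => z + t • v) (𝓝 0) (𝓝 z) := by
    simpa using (hasDerivAt_add_smul z v 0).continuousAt.tendsto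
  have hderiv : deriv (fun t : ℝ => F (z + t • v)) =ᶠ[𝓝 0] fun t => fderiv ℝ F (z + t • v) v := by
    filter_upwards [hline.eventually (hF.eventually (by simp))] with t ht
    exact ((ht.differentiableAt two_ne_zero).hasFDerivAt.comp_hasDerivAt t
      (hasDerivAt_add_smul z v t)).deriv
  have hdF : HasFDerivAt (fun w => fderiv ℝ F w v) (fderiv ℝ (fun w => fderiv ℝ F w v) z)
      (z + (0 : ℝ) • v) := by
    simpa using (differentiableAt_fderiv_apply hF v).hasFDerivAt
  rw [hderiv.deriv_eq]
  exact (hdF.comp_hasDerivAt 0 (hasDerivAt_add_smul z v 0)).deriv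

/- A positive second derivative would make the local maximum a local minimum as well, hence the
function locally constant. -/
lemma deriv_deriv_nonpos_of_isLocalMax {h : ℝ → ℝ} {t : ℝ} (hcont : ContinuousAt h t)
    (hmax : IsLocalMax h t) : deriv (deriv h) t ≤ 0 := by
  by_contra! hpos
  have hmin : IsLocalMin h t := isLocalMin_of_deriv_deriv_pos hpos hmax.deriv_eq_zero hcont
  have hconst : h =ᶠ[𝓝 t] fun _ => h t := by
    filter_upwards [hmin, hmax] with s h₁ h₂ using le_antisymm h₂ h₁
  rw [hconst.deriv.deriv_eq] at hpos
  simp at hpos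

lemma fderiv_fderiv_nonpos_of_isLocalMax {u : E → ℝ} (hu : ContDiffAt ℝ 2 u z)
    (hmax : IsLocalMax u z) (v : E) : fderiv ℝ (fun w => fderiv ℝ u w v) z v ≤ 0 := by
  have hline : ContinuousAt (fun t : ℝ => z + t • v) 0 :=
    (hasDerivAt_add_smul z v 0).continuousAt
  have hz : z + (0 : ℝ) • v = z := by simp
  rw [← deriv_deriv_comp_add_smul hu v]
  rw [← hz] at hu hmax
  exact deriv_deriv_nonpos_of_isLocalMax
    (ContinuousAt.comp' (f := fun t : ℝ => z + t • v) hu.continuousAt hline)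
    (IsMaxFilter.comp_tendsto (g := fun t : ℝ => z + t • v) hmax hline.tendsto)

end RealCalculus

section WirtingerCalculus

variable {F G : C2 → ℂ} {z : C2} {i j : Fin 2}

lemma dy_eq_I_smul_dx (i : Fin 2) : dy i = Complex.I • dx i := by
  ext r
  by_cases h : r = i <;> simp [dx, dy, h]

lemma sum_smul_dx (v : C2) : ∑ r, v r • dx r = v := by
  ext r
  fin_cases r <;> simp [dx, Fin.sum_univ_two]

lemma wirtinger_congr (h : F =ᶠ[𝓝 z] G) : wirtinger i F z = wirtinger i G z := by
  simp only [wirtinger, h.fderiv_eq]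

lemma wirtingerBar_congr (h : F =ᶠ[𝓝 z] G) : wirtingerBar i F z = wirtingerBar i G z := by
  simp only [wirtingerBar, h.fderiv_eq]

lemma eventuallyEq_wirtingerBar (h : F =ᶠ[𝓝 z] G) : wirtingerBar i F =ᶠ[𝓝 z] wirtingerBar i G :=
  h.eventuallyEq_nhds.mono fun _ => wirtingerBar_congr

lemma wirtinger_add (hF : DifferentiableAt ℝ F z) (hG : DifferentiableAt ℝ G z) :
    wirtinger i (fun w => F w + G w) z = wirtinger i F z + wirtinger i G z := by
  simp only [wirtinger, fderiv_fun_add hF hG, add_apply]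
  ring

lemma wirtingerBar_add (hF : DifferentiableAt ℝ F z) (hG : DifferentiableAt ℝ G z) :
    wirtingerBar i (fun w => F w + G w) z = wirtingerBar i F z + wirtingerBar i G z := by
  simp only [wirtingerBar, fderiv_fun_add hF hG, add_apply]
  ring

lemma wirtinger_sub (hF : DifferentiableAt ℝ F z) (hG : DifferentiableAt ℝ G z) :
    wirtinger i (fun w => F w - G w) z = wirtinger i F z - wirtinger i G z := by
  simp only [wirtinger, fderiv_fun_sub hF hG, sub_apply]
  ring

lemma wirtingerBar_sub (hF : DifferentiableAt ℝ F z) (hG : DifferentiableAt ℝ G z) :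
    wirtingerBar i (fun w => F w - G w) z = wirtingerBar i F z - wirtingerBar i G z := by
  simp only [wirtingerBar, fderiv_fun_sub hF hG, sub_apply]
  ring

lemma wirtinger_mul (hF : DifferentiableAt ℝ F z) (hG : DifferentiableAt ℝ G z) :
    wirtinger i (fun w => F w * G w) z = wirtinger i F z * G z + F z * wirtinger i G z := by
  simp only [wirtinger, fderiv_fun_mul hF hG, add_apply, smul_apply, smul_eq_mul]
  ring

lemma wirtingerBar_mul (hF : DifferentiableAt ℝ F z) (hG : DifferentiableAt ℝ G z) :
    wirtingerBar i (fun w => F w * G w) z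
      = wirtingerBar i F z * G z + F z * wirtingerBar i G z := by
  simp only [wirtingerBar, fderiv_fun_mul hF hG, add_apply, smul_apply, smul_eq_mul]
  ring

lemma wirtinger_const_mul (c : ℂ) :
    wirtinger i (fun w => c * F w) z = c * wirtinger i F z := by
  have h : fderiv ℝ (fun w => c * F w) = c • fderiv ℝ F := fderiv_const_smul_field c
  simp only [wirtinger, h, Pi.smul_apply, smul_apply, smul_eq_mul]
  ring

lemma wirtingerBar_const_mul (c : ℂ) :
    wirtingerBar i (fun w => c * F w) z = c * wirtingerBar i F z := by
  have h : fderiv ℝ (fun w => c * F w) = c • fderiv ℝ F := fderiv_const_smul_field c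
  simp only [wirtingerBar, h, Pi.smul_apply, smul_apply, smul_eq_mul]
  ring

lemma wirtinger_sum {ι : Type*} (s : Finset ι) {F : ι → C2 → ℂ}
    (hF : ∀ k ∈ s, DifferentiableAt ℝ (F k) z) :
    wirtinger i (fun w => ∑ k ∈ s, F k w) z = ∑ k ∈ s, wirtinger i (F k) z := by
  simp only [wirtinger, fderiv_fun_sum hF, sum_apply, Finset.mul_sum, ← Finset.sum_sub_distrib]

lemma wirtingerBar_sum {ι : Type*} (s : Finset ι) {F : ι → C2 → ℂ}
    (hF : ∀ k ∈ s, DifferentiableAt ℝ (F k) z) :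
    wirtingerBar i (fun w => ∑ k ∈ s, F k w) z = ∑ k ∈ s, wirtingerBar i (F k) z := by
  simp only [wirtingerBar, fderiv_fun_sum hF, sum_apply, Finset.mul_sum, ← Finset.sum_add_distrib]

lemma wirtinger_conj : wirtinger i (fun w => conj (F w)) z = conj (wirtingerBar i F z) := by
  simp only [wirtinger, wirtingerBar, fderiv_conj_apply, map_mul, map_add, Complex.conj_I,
    map_div₀, map_one, map_ofNat]
  ring

lemma wirtingerBar_conj : wirtingerBar i (fun w => conj (F w)) z = conj (wirtinger i F z) := by
  simp only [wirtinger, wirtingerBar, fderiv_conj_apply, map_mul, map_sub, Complex.conj_I,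
    map_div₀, map_one, map_ofNat]
  ring

lemma contDiffAt_wirtinger {m n : ℕ∞ω} (hF : ContDiffAt ℝ n F z) (hmn : m + 1 ≤ n) :
    ContDiffAt ℝ m (wirtinger i F) z :=
  contDiffAt_const.mul ((contDiffAt_fderiv_apply hF hmn _).sub
    (contDiffAt_const.mul (contDiffAt_fderiv_apply hF hmn _)))

lemma contDiffAt_wirtingerBar {m n : ℕ∞ω} (hF : ContDiffAt ℝ n F z) (hmn : m + 1 ≤ n) :
    ContDiffAt ℝ m (wirtingerBar i F) z :=
  contDiffAt_const.mul ((contDiffAt_fderiv_apply hF hmn _).add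
    (contDiffAt_const.mul (contDiffAt_fderiv_apply hF hmn _)))

lemma differentiableAt_wirtingerBar (hF : ContDiffAt ℝ 2 F z) :
    DifferentiableAt ℝ (wirtingerBar i F) z :=
  (contDiffAt_wirtingerBar (m := 1) hF (by norm_num)).differentiableAt one_ne_zero

lemma fderiv_wirtinger (hF : ContDiffAt ℝ 2 F z) (v : C2) :
    fderiv ℝ (wirtinger i F) z v = wirtinger i (fun x => fderiv ℝ F x v) z := by
  have hx := differentiableAt_fderiv_apply hF (dx i)
  have hy := (differentiableAt_fderiv_apply hF (dy i)).const_mul Complex.I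
  change fderiv ℝ (fun w => 1 / 2 * (fderiv ℝ F w (dx i) - Complex.I * fderiv ℝ F w (dy i))) z v = _
  rw [fderiv_const_mul (hx.fun_sub hy), fderiv_fun_sub hx hy,
    fderiv_const_mul (differentiableAt_fderiv_apply hF (dy i)), wirtinger,
    fderiv_fderiv_apply_comm hF v, fderiv_fderiv_apply_comm hF v]
  rfl

lemma fderiv_wirtingerBar (hF : ContDiffAt ℝ 2 F z) (v : C2) :
    fderiv ℝ (wirtingerBar i F) z v = wirtingerBar i (fun x => fderiv ℝ F x v) z := by
  have hx := differentiableAt_fderiv_apply hF (dx i)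
  have hy := (differentiableAt_fderiv_apply hF (dy i)).const_mul Complex.I
  change fderiv ℝ (fun w => 1 / 2 * (fderiv ℝ F w (dx i) + Complex.I * fderiv ℝ F w (dy i))) z v = _
  rw [fderiv_const_mul (hx.fun_add hy), fderiv_fun_add hx hy,
    fderiv_const_mul (differentiableAt_fderiv_apply hF (dy i)), wirtingerBar,
    fderiv_fderiv_apply_comm hF v, fderiv_fderiv_apply_comm hF v]
  rfl

lemma wirtinger_comm (hF : ContDiffAt ℝ 2 F z) :
    wirtinger i (wirtinger j F) z = wirtinger j (wirtinger i F) z := by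
  rw [wirtinger, fderiv_wirtinger hF, fderiv_wirtinger hF, wirtinger, wirtinger, wirtinger,
    fderiv_wirtinger hF, fderiv_wirtinger hF, wirtinger, wirtinger,
    fderiv_fderiv_apply_comm hF (dx i) (dx j), fderiv_fderiv_apply_comm hF (dx i) (dy j),
    fderiv_fderiv_apply_comm hF (dy i) (dx j), fderiv_fderiv_apply_comm hF (dy i) (dy j)]
  ring

lemma wirtinger_wirtingerBar_comm (hF : ContDiffAt ℝ 2 F z) :
    wirtinger i (wirtingerBar j F) z = wirtingerBar j (wirtinger i F) z := by
  rw [wirtinger, fderiv_wirtingerBar hF, fderiv_wirtingerBar hF, wirtingerBar, wirtingerBar,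
    wirtingerBar, fderiv_wirtinger hF, fderiv_wirtinger hF, wirtinger, wirtinger,
    fderiv_fderiv_apply_comm hF (dx i) (dx j), fderiv_fderiv_apply_comm hF (dx i) (dy j),
    fderiv_fderiv_apply_comm hF (dy i) (dx j), fderiv_fderiv_apply_comm hF (dy i) (dy j)]
  ring

lemma fderiv_eq_sum_wirtinger (v : C2) :
    fderiv ℝ F z v = ∑ r, (v r * wirtinger r F z + conj (v r) * wirtingerBar r F z) := by
  have hsmul (r : Fin 2) : fderiv ℝ F z (v r • dx r)
      = v r * wirtinger r F z + conj (v r) * wirtingerBar r F z := by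
    have hreal : v r • dx r = (v r).re • dx r + (v r).im • dy r := by
      rw [dy_eq_I_smul_dx]
      conv_lhs => rw [← Complex.re_add_im (v r)]
      rw [add_smul, mul_smul, Complex.coe_smul, Complex.coe_smul]
    rw [hreal, map_add, map_smul, map_smul, wirtinger, wirtingerBar, Complex.real_smul,
      Complex.real_smul]
    conv_rhs => rw [← Complex.re_add_im (v r)]
    simp only [map_add, map_mul, Complex.conj_ofReal, Complex.conj_I]
    linear_combination ((v r).im * fderiv ℝ F z (dy r)) * Complex.I_sq
  conv_lhs => rw [← sum_smul_dx v]
  rw [map_sum]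
  exact Finset.sum_congr rfl fun r _ => hsmul r

end WirtingerCalculus

/-- The matrix of the sesquilinear form with matrix `G` in the frame formed by the columns
of `P`. -/
def inFrame {m n : Type*} [Fintype m] (P : Matrix m n ℂ) (G : Matrix m m ℂ) : Matrix n n ℂ :=
  P.transpose * G * P.map conj

lemma inFrame_apply {m n : Type*} [Fintype m] (P : Matrix m n ℂ) (G : Matrix m m ℂ) (i j : n) :
    inFrame P G i j = ∑ r, ∑ s, P r i * G r s * conj (P s j) := by
  simp only [inFrame, Matrix.mul_apply, Matrix.transpose_apply, Matrix.map_apply, Finset.sum_mul]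
  exact Finset.sum_comm

lemma inFrame_add {m n : Type*} [Fintype m] (P : Matrix m n ℂ) (G H : Matrix m m ℂ) :
    inFrame P (G + H) = inFrame P G + inFrame P H := by
  simp only [inFrame, Matrix.mul_add, Matrix.add_mul]

section Holomorphic

variable {F : C2 → ℂ} {τ : C2 → C2} {z : C2} {i j : Fin 2}

/-- The Jacobian matrix `∂τʳ/∂zⁱ` of a holomorphic map. -/
def jacobian (τ : C2 → C2) (z : C2) : Matrix (Fin 2) (Fin 2) ℂ :=
  Matrix.of fun r i => fderiv ℂ τ z (dx i) r

lemma fderiv_comp_holomorphic (hτ : DifferentiableAt ℂ τ z) (hF : DifferentiableAt ℝ F (τ z))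
    (v : C2) : fderiv ℝ (fun w => F (τ w)) z v = fderiv ℝ F (τ z) (fderiv ℂ τ z v) :=
  DFunLike.congr_fun (hF.hasFDerivAt.comp z (hτ.hasFDerivAt.restrictScalars ℝ)).fderiv v

lemma wirtinger_comp (hτ : DifferentiableAt ℂ τ z) (hF : DifferentiableAt ℝ F (τ z)) :
    wirtinger i (fun w => F (τ w)) z = ∑ r, jacobian τ z r i * wirtinger r F (τ z) := by
  rw [wirtinger, fderiv_comp_holomorphic hτ hF, fderiv_comp_holomorphic hτ hF, dy_eq_I_smul_dx,
    map_smul, fderiv_eq_sum_wirtinger, fderiv_eq_sum_wirtinger]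
  simp only [Fin.sum_univ_two, jacobian, Matrix.of_apply, PiLp.smul_apply, smul_eq_mul, map_mul,
    Complex.conj_I]
  ring_nf
  simp only [Complex.I_sq]
  ring

lemma wirtingerBar_comp (hτ : DifferentiableAt ℂ τ z) (hF : DifferentiableAt ℝ F (τ z)) :
    wirtingerBar i (fun w => F (τ w)) z
      = ∑ r, conj (jacobian τ z r i) * wirtingerBar r F (τ z) := by
  have hconj : DifferentiableAt ℝ (fun w => conj (F w)) (τ z) := hF.star
  have h := congrArg conj (wirtinger_comp (i := i) hτ hconj)
  rw [wirtinger_conj (F := fun w => F (τ w)), Complex.conj_conj] at h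
  simp only [h, wirtinger_conj, map_sum, map_mul, Complex.conj_conj]

lemma wirtingerBar_eq_zero (hF : DifferentiableAt ℂ F z) : wirtingerBar i F z = 0 := by
  rw [wirtingerBar, (hF.hasFDerivAt.restrictScalars ℝ).fderiv, dy_eq_I_smul_dx]
  simp only [ContinuousLinearMap.coe_restrictScalars', map_smul, smul_eq_mul]
  linear_combination (1 / 2 * fderiv ℂ F z (dx i)) * Complex.I_sq

lemma differentiableAt_jacobian (hτ : ContDiffAt ℂ 2 τ z) (r i : Fin 2) :
    DifferentiableAt ℂ (fun w => jacobian τ w r i) z := by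
  have hdτ : ContDiffAt ℂ 1 (fun w => fderiv ℂ τ w (dx i)) z :=
    (hτ.fderiv_right (m := 1) (by norm_num)).clm_apply contDiffAt_const
  exact (differentiableAt_piLp 2).1 (hdτ.differentiableAt one_ne_zero) r

lemma wirtinger_wirtingerBar_comp (hτ : ContDiffAt ℂ 2 τ z) (hF : ContDiffAt ℝ 2 F (τ z)) :
    wirtinger i (wirtingerBar j fun w => F (τ w)) z
      = inFrame (jacobian τ z) (.of fun r s => wirtinger r (wirtingerBar s F) (τ z)) i j := by
  have hbar : wirtingerBar j (fun w => F (τ w)) =ᶠ[𝓝 z]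
      fun w => ∑ s, conj (jacobian τ w s j) * wirtingerBar s F (τ w) := by
    filter_upwards [hτ.eventually (by simp),
      hτ.continuousAt.eventually (hF.eventually (by simp))] with w hτw hFw
    exact wirtingerBar_comp (hτw.differentiableAt two_ne_zero)
      (hFw.differentiableAt two_ne_zero)
  have hτ' : DifferentiableAt ℂ τ z := hτ.differentiableAt two_ne_zero
  have hJ (s : Fin 2) : DifferentiableAt ℝ (fun w => conj (jacobian τ w s j)) z :=
    ((differentiableAt_jacobian hτ s j).restrictScalars ℝ).star
  have hF' (s : Fin 2) : DifferentiableAt ℝ (wirtingerBar s F) (τ z) :=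
    differentiableAt_wirtingerBar hF
  have hFτ (s : Fin 2) : DifferentiableAt ℝ (fun w => wirtingerBar s F (τ w)) z :=
    (hF' s).comp z (hτ'.restrictScalars ℝ)
  rw [wirtinger_congr hbar, wirtinger_sum _ fun s _ => (hJ s).fun_mul (hFτ s), inFrame_apply,
    Finset.sum_comm]
  refine Finset.sum_congr rfl fun s _ => ?_
  rw [wirtinger_mul (hJ s) (hFτ s), wirtinger_conj,
    wirtingerBar_eq_zero (differentiableAt_jacobian hτ s j), wirtinger_comp hτ' (hF' s),
    map_zero, zero_mul, zero_add, Finset.mul_sum]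
  exact Finset.sum_congr rfl fun r _ => by rw [Matrix.of_apply]; ring

lemma complexHessian_comp {u : C2 → ℝ} (hτ : ContDiffAt ℂ 2 τ z) (hu : ContDiffAt ℝ 2 u (τ z)) :
    complexHessian (u ∘ τ) z = inFrame (jacobian τ z) (complexHessian u (τ z)) := by
  ext i j
  exact wirtinger_wirtingerBar_comp (F := fun w => (u w : ℂ)) hτ (contDiffAt_ofReal hu)

end Holomorphic

section SecondOrder

variable {F G : C2 → ℂ} {z : C2} {i j : Fin 2}

lemma wirtinger_wirtingerBar_add (hF : ContDiffAt ℝ 2 F z) (hG : ContDiffAt ℝ 2 G z) :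
    wirtinger i (wirtingerBar j fun w => F w + G w) z
      = wirtinger i (wirtingerBar j F) z + wirtinger i (wirtingerBar j G) z := by
  have hbar : wirtingerBar j (fun w => F w + G w) =ᶠ[𝓝 z]
      fun w => wirtingerBar j F w + wirtingerBar j G w := by
    filter_upwards [hF.eventually (by simp), hG.eventually (by simp)] with w hFw hGw
    exact wirtingerBar_add (hFw.differentiableAt two_ne_zero) (hGw.differentiableAt two_ne_zero)
  rw [wirtinger_congr hbar,
    wirtinger_add (differentiableAt_wirtingerBar hF) (differentiableAt_wirtingerBar hG)]

lemma wirtinger_wirtingerBar_sub (hF : ContDiffAt ℝ 2 F z) (hG : ContDiffAt ℝ 2 G z) :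
    wirtinger i (wirtingerBar j fun w => F w - G w) z
      = wirtinger i (wirtingerBar j F) z - wirtinger i (wirtingerBar j G) z := by
  have hbar : wirtingerBar j (fun w => F w - G w) =ᶠ[𝓝 z]
      fun w => wirtingerBar j F w - wirtingerBar j G w := by
    filter_upwards [hF.eventually (by simp), hG.eventually (by simp)] with w hFw hGw
    exact wirtingerBar_sub (hFw.differentiableAt two_ne_zero) (hGw.differentiableAt two_ne_zero)
  rw [wirtinger_congr hbar,
    wirtinger_sub (differentiableAt_wirtingerBar hF) (differentiableAt_wirtingerBar hG)]

lemma wirtinger_wirtingerBar_mul (hF : ContDiffAt ℝ 2 F z) (hG : ContDiffAt ℝ 2 G z) :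
    wirtinger i (wirtingerBar j fun w => F w * G w) z
      = wirtinger i (wirtingerBar j F) z * G z + wirtingerBar j F z * wirtinger i G z
        + wirtinger i F z * wirtingerBar j G z + F z * wirtinger i (wirtingerBar j G) z := by
  have hbar : wirtingerBar j (fun w => F w * G w) =ᶠ[𝓝 z]
      fun w => wirtingerBar j F w * G w + F w * wirtingerBar j G w := by
    filter_upwards [hF.eventually (by simp), hG.eventually (by simp)] with w hFw hGw
    exact wirtingerBar_mul (hFw.differentiableAt two_ne_zero) (hGw.differentiableAt two_ne_zero)
  have hF₁ : DifferentiableAt ℝ F z := hF.differentiableAt two_ne_zero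
  have hG₁ : DifferentiableAt ℝ G z := hG.differentiableAt two_ne_zero
  have hF₂ : DifferentiableAt ℝ (wirtingerBar j F) z := differentiableAt_wirtingerBar hF
  have hG₂ : DifferentiableAt ℝ (wirtingerBar j G) z := differentiableAt_wirtingerBar hG
  rw [wirtinger_congr hbar, wirtinger_add (hF₂.fun_mul hG₁) (hF₁.fun_mul hG₂),
    wirtinger_mul hF₂ hG₁, wirtinger_mul hF₁ hG₂]
  ring

end SecondOrder

section ComplexHessian

variable {u v : C2 → ℝ} {z : C2} {i j : Fin 2}

lemma wirtingerBar_ofReal : wirtingerBar i (fun w => (u w : ℂ)) z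
    = conj (wirtinger i (fun w => (u w : ℂ)) z) := by
  simp only [← wirtingerBar_conj, Complex.conj_ofReal]

lemma isHermitian_complexHessian (hu : ContDiffAt ℝ 2 u z) : (complexHessian u z).IsHermitian := by
  ext i j
  have hbar : wirtinger j (fun w => (u w : ℂ))
      = fun w => conj (wirtingerBar j (fun w => (u w : ℂ)) w) := by
    ext w
    rw [wirtingerBar_ofReal, Complex.conj_conj]
  simp only [Matrix.conjTranspose_apply, complexHessian, Matrix.of_apply, RCLike.star_def]
  rw [wirtinger_wirtingerBar_comm (contDiffAt_ofReal hu), hbar, wirtingerBar_conj,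
    Complex.conj_conj]

lemma complexHessian_sub (hu : ContDiffAt ℝ 2 u z) (hv : ContDiffAt ℝ 2 v z) :
    complexHessian (fun w => u w - v w) z = complexHessian u z - complexHessian v z := by
  ext i j
  simp only [complexHessian, Matrix.of_apply, Matrix.sub_apply, Complex.ofReal_sub]
  exact wirtinger_wirtingerBar_sub (contDiffAt_ofReal hu) (contDiffAt_ofReal hv)

lemma complexHessian_const_mul (c : ℝ) (u : C2 → ℝ) (z : C2) :
    complexHessian (fun w => c * u w) z = (c : ℂ) • complexHessian u z := by
  ext i j
  simp only [complexHessian, Matrix.of_apply, Matrix.smul_apply, smul_eq_mul, Complex.ofReal_mul,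
    funext fun w => wirtingerBar_const_mul (i := j) (F := fun w => (u w : ℂ)) (z := w) (c : ℂ),
    wirtinger_const_mul]

lemma wirtinger_log (hu : DifferentiableAt ℝ u z) (hz : u z ≠ 0) :
    wirtinger i (fun w => (Real.log (u w) : ℂ)) z = wirtinger i (fun w => (u w : ℂ)) z / u z := by
  simp only [wirtinger, fderiv_ofReal_apply (hu.log hz), fderiv_ofReal_apply hu, fderiv.log hu hz,
    smul_apply, smul_eq_mul, Complex.ofReal_mul, Complex.ofReal_inv]
  ring

lemma complexHessian_log (hu : ContDiffAt ℝ 2 u z) (hz : u z ≠ 0) :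
    complexHessian (fun w => Real.log (u w)) z i j = complexHessian u z i j / u z
      - wirtinger i (fun w => (u w : ℂ)) z * wirtingerBar j (fun w => (u w : ℂ)) z / u z ^ 2 := by
  have hbar {w : C2} (hw : DifferentiableAt ℝ u w) (hw₀ : u w ≠ 0) :
      wirtingerBar j (fun w => (Real.log (u w) : ℂ)) w
        = wirtingerBar j (fun w => (u w : ℂ)) w / u w := by
    simp only [wirtingerBar_ofReal (u := fun w => Real.log (u w)), wirtinger_log hw hw₀, map_div₀,
      Complex.conj_ofReal, wirtingerBar_ofReal]
  have hmul : wirtingerBar j (fun w => (u w : ℂ)) =ᶠ[𝓝 z]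
      fun w => u w * wirtingerBar j (fun w => (Real.log (u w) : ℂ)) w := by
    filter_upwards [hu.eventually (by simp), hu.continuousAt.eventually_ne hz] with w hw hw₀
    rw [hbar (hw.differentiableAt two_ne_zero) hw₀, mul_div_cancel₀ _ (by exact_mod_cast hw₀)]
  have hderiv := wirtinger_congr (i := i) hmul
  rw [wirtinger_mul ((contDiffAt_ofReal hu).differentiableAt two_ne_zero)
    (differentiableAt_wirtingerBar (contDiffAt_ofReal (hu.log hz))),
    hbar (hu.differentiableAt two_ne_zero) hz] at hderiv
  have hz' : (u z : ℂ) ≠ 0 := by exact_mod_cast hz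
  simp only [complexHessian, Matrix.of_apply, hderiv]
  field_simp
  ring

lemma complexHessian_apply_self (hu : ContDiffAt ℝ 2 u z) :
    complexHessian u z i i = ((fderiv ℝ (fun w => fderiv ℝ u w (dx i)) z (dx i)
      + fderiv ℝ (fun w => fderiv ℝ u w (dy i)) z (dy i)) / 4 : ℝ) := by
  have hu' := contDiffAt_ofReal hu
  rw [complexHessian, Matrix.of_apply, wirtinger, fderiv_wirtingerBar hu', fderiv_wirtingerBar hu',
    wirtingerBar, wirtingerBar, fderiv_fderiv_ofReal_apply hu, fderiv_fderiv_ofReal_apply hu,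
    fderiv_fderiv_ofReal_apply hu, fderiv_fderiv_ofReal_apply hu,
    fderiv_fderiv_apply_comm hu (dy i) (dx i)]
  push_cast
  linear_combination
    (-1 / 4 * fderiv ℝ (fun w => fderiv ℝ u w (dy i)) z (dy i) : ℂ) * Complex.I_sq

lemma re_complexHessian_apply_self_nonpos_of_isLocalMax (hu : ContDiffAt ℝ 2 u z)
    (hmax : IsLocalMax u z) : (complexHessian u z i i).re ≤ 0 := by
  rw [complexHessian_apply_self hu, Complex.ofReal_re]
  linarith [fderiv_fderiv_nonpos_of_isLocalMax hu hmax (dx i),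
    fderiv_fderiv_nonpos_of_isLocalMax hu hmax (dy i)]

end ComplexHessian

section MatrixCalculus

/-- The entrywise derivative `∂G/∂zᵏ` of a matrix-valued function. -/
def matrixWirtinger (k : Fin 2) (G : C2 → Matrix (Fin 2) (Fin 2) ℂ) (z : C2) :
    Matrix (Fin 2) (Fin 2) ℂ :=
  Matrix.of fun i j => wirtinger k (fun w => G w i j) z

/-- The entrywise derivative `∂G/∂z̄ᵏ` of a matrix-valued function. -/
def matrixWirtingerBar (k : Fin 2) (G : C2 → Matrix (Fin 2) (Fin 2) ℂ) (z : C2) :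
    Matrix (Fin 2) (Fin 2) ℂ :=
  Matrix.of fun i j => wirtingerBar k (fun w => G w i j) z

/-- The polarised determinant: the symmetric bilinear form with `mixedDet A A = 2 det A`. -/
def mixedDet (A B : Matrix (Fin 2) (Fin 2) ℂ) : ℂ :=
  A 0 0 * B 1 1 + A 1 1 * B 0 0 - A 0 1 * B 1 0 - A 1 0 * B 0 1

lemma mixedDet_self (A : Matrix (Fin 2) (Fin 2) ℂ) : mixedDet A A = 2 * A.det := by
  rw [mixedDet, Matrix.det_fin_two]
  ring

lemma mixedDet_comm (A B : Matrix (Fin 2) (Fin 2) ℂ) : mixedDet A B = mixedDet B A := by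
  simp only [mixedDet]
  ring

lemma mixedDet_one_left (A : Matrix (Fin 2) (Fin 2) ℂ) : mixedDet 1 A = A.trace := by
  simp [mixedDet, Matrix.trace_fin_two, add_comm]

lemma mixedDet_one_right (A : Matrix (Fin 2) (Fin 2) ℂ) : mixedDet A 1 = A.trace := by
  simp [mixedDet, Matrix.trace_fin_two]

lemma mixedDet_diagonal (A : Matrix (Fin 2) (Fin 2) ℂ) (a b : ℂ) :
    mixedDet A (Matrix.diagonal ![a, b]) = b * A 0 0 + a * A 1 1 := by
  simp [mixedDet, mul_comm]

variable {G H : C2 → Matrix (Fin 2) (Fin 2) ℂ} {z : C2}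

lemma wirtinger_mixedDet (hG : ∀ i j, DifferentiableAt ℝ (fun w => G w i j) z)
    (hH : ∀ i j, DifferentiableAt ℝ (fun w => H w i j) z) (k : Fin 2) :
    wirtinger k (fun w => mixedDet (G w) (H w)) z
      = mixedDet (matrixWirtinger k G z) (H z) + mixedDet (G z) (matrixWirtinger k H z) := by
  simp (disch := fun_prop) only [mixedDet, matrixWirtinger, Matrix.of_apply, wirtinger_sub,
    wirtinger_add, wirtinger_mul]
  ring

lemma contDiffAt_mixedDet {n : ℕ∞ω} (hG : ∀ i j, ContDiffAt ℝ n (fun w => G w i j) z)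
    (hH : ∀ i j, ContDiffAt ℝ n (fun w => H w i j) z) :
    ContDiffAt ℝ n (fun w => mixedDet (G w) (H w)) z := by
  unfold mixedDet
  fun_prop

lemma wirtingerBar_mixedDet (hG : ∀ i j, DifferentiableAt ℝ (fun w => G w i j) z)
    (hH : ∀ i j, DifferentiableAt ℝ (fun w => H w i j) z) (k : Fin 2) :
    wirtingerBar k (fun w => mixedDet (G w) (H w)) z
      = mixedDet (matrixWirtingerBar k G z) (H z)
        + mixedDet (G z) (matrixWirtingerBar k H z) := by
  simp (disch := fun_prop) only [mixedDet, matrixWirtingerBar, Matrix.of_apply, wirtingerBar_sub,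
    wirtingerBar_add, wirtingerBar_mul]
  ring

lemma wirtinger_wirtingerBar_mixedDet (hG : ∀ i j, ContDiffAt ℝ 2 (fun w => G w i j) z)
    (hH : ∀ i j, ContDiffAt ℝ 2 (fun w => H w i j) z) (k l : Fin 2) :
    wirtinger k (wirtingerBar l fun w => mixedDet (G w) (H w)) z
      = mixedDet (matrixWirtinger k (matrixWirtingerBar l G) z) (H z)
        + mixedDet (matrixWirtingerBar l G z) (matrixWirtinger k H z)
        + mixedDet (matrixWirtinger k G z) (matrixWirtingerBar l H z)
        + mixedDet (G z) (matrixWirtinger k (matrixWirtingerBar l H) z) := by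
  simp (disch := fun_prop) only [mixedDet, matrixWirtinger, matrixWirtingerBar, Matrix.of_apply,
    wirtinger_wirtingerBar_sub, wirtinger_wirtingerBar_add, wirtinger_wirtingerBar_mul]
  ring

end MatrixCalculus

section MulDet

variable {G A B : C2 → Matrix (Fin 2) (Fin 2) ℂ} {T : C2 → ℂ} {z : C2}

lemma eventuallyEq_mul_mixedDet_self (h : ∀ᶠ w in 𝓝 z, T w * (G w).det = mixedDet (A w) (B w)) :
    (fun w => T w * mixedDet (G w) (G w)) =ᶠ[𝓝 z] fun w => 2 * mixedDet (A w) (B w) := by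
  filter_upwards [h] with w hw
  rw [mixedDet_self, ← hw]
  ring

section FirstOrder

variable (hG : ∀ i j, DifferentiableAt ℝ (fun w => G w i j) z)
  (hA : ∀ i j, DifferentiableAt ℝ (fun w => A w i j) z)
  (hB : ∀ i j, DifferentiableAt ℝ (fun w => B w i j) z) (hT : DifferentiableAt ℝ T z)
  (h : ∀ᶠ w in 𝓝 z, T w * (G w).det = mixedDet (A w) (B w)) (hGz : G z = 1)
include hG hA hB hT h hGz

lemma wirtinger_of_mul_det_eq (k : Fin 2) :
    wirtinger k T z = mixedDet (matrixWirtinger k A z) (B z)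
      + mixedDet (A z) (matrixWirtinger k B z) - T z * (matrixWirtinger k G z).trace := by
  have hmix : DifferentiableAt ℝ (fun w => mixedDet (G w) (G w)) z := by
    unfold mixedDet
    fun_prop
  have hderiv := wirtinger_congr (i := k) (eventuallyEq_mul_mixedDet_self h)
  rw [wirtinger_mul hT hmix, wirtinger_const_mul, wirtinger_mixedDet hG hG,
    wirtinger_mixedDet hA hB, hGz, mixedDet_self, Matrix.det_one, mixedDet_one_left,
    mixedDet_one_right] at hderiv
  linear_combination hderiv / 2

lemma wirtingerBar_of_mul_det_eq (k : Fin 2) :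
    wirtingerBar k T z = mixedDet (matrixWirtingerBar k A z) (B z)
      + mixedDet (A z) (matrixWirtingerBar k B z) - T z * (matrixWirtingerBar k G z).trace := by
  have hmix : DifferentiableAt ℝ (fun w => mixedDet (G w) (G w)) z := by
    unfold mixedDet
    fun_prop
  have hderiv := wirtingerBar_congr (i := k) (eventuallyEq_mul_mixedDet_self h)
  rw [wirtingerBar_mul hT hmix, wirtingerBar_const_mul, wirtingerBar_mixedDet hG hG,
    wirtingerBar_mixedDet hA hB, hGz, mixedDet_self, Matrix.det_one, mixedDet_one_left,
    mixedDet_one_right] at hderiv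
  linear_combination hderiv / 2

end FirstOrder

lemma wirtinger_wirtingerBar_of_mul_det_eq (hG : ∀ i j, ContDiffAt ℝ 2 (fun w => G w i j) z)
    (hA : ∀ i j, ContDiffAt ℝ 2 (fun w => A w i j) z)
    (hB : ∀ i j, ContDiffAt ℝ 2 (fun w => B w i j) z) (hT : ContDiffAt ℝ 2 T z)
    (h : ∀ᶠ w in 𝓝 z, T w * (G w).det = mixedDet (A w) (B w)) (hGz : G z = 1) (k l : Fin 2) :
    wirtinger k (wirtingerBar l T) z
      = mixedDet (matrixWirtinger k (matrixWirtingerBar l A) z) (B z)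
        + mixedDet (matrixWirtingerBar l A z) (matrixWirtinger k B z)
        + mixedDet (matrixWirtinger k A z) (matrixWirtingerBar l B z)
        + mixedDet (A z) (matrixWirtinger k (matrixWirtingerBar l B) z)
        - wirtingerBar l T z * (matrixWirtinger k G z).trace
        - wirtinger k T z * (matrixWirtingerBar l G z).trace
        - T z * ((matrixWirtinger k (matrixWirtingerBar l G) z).trace
          + mixedDet (matrixWirtinger k G z) (matrixWirtingerBar l G z)) := by
  have hG₁ (i j) := (hG i j).differentiableAt two_ne_zero
  have hderiv := wirtinger_congr (i := k)
    (eventuallyEq_wirtingerBar (i := l) (eventuallyEq_mul_mixedDet_self h))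
  have hconst : wirtingerBar l (fun w => 2 * mixedDet (A w) (B w))
      = fun w => 2 * wirtingerBar l (fun w => mixedDet (A w) (B w)) w :=
    funext fun w => wirtingerBar_const_mul 2
  rw [wirtinger_wirtingerBar_mul hT (contDiffAt_mixedDet hG hG), hconst, wirtinger_const_mul,
    wirtinger_wirtingerBar_mixedDet hA hB, wirtinger_wirtingerBar_mixedDet hG hG,
    wirtinger_mixedDet hG₁ hG₁, wirtingerBar_mixedDet hG₁ hG₁, hGz, mixedDet_self,
    Matrix.det_one, mixedDet_one_left, mixedDet_one_right, mixedDet_one_left, mixedDet_one_right,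
    mixedDet_one_left, mixedDet_one_right,
    mixedDet_comm (matrixWirtingerBar l G z)] at hderiv
  linear_combination hderiv / 2

end MulDet

section CovariantDerivatives

/-- The derivative `∇_k H` with respect to the Chern connection of the Hermitian form `G`. -/
def covDeriv (G H : C2 → Matrix (Fin 2) (Fin 2) ℂ) (k : Fin 2) (z : C2) :
    Matrix (Fin 2) (Fin 2) ℂ :=
  matrixWirtinger k H z - matrixWirtinger k G z * (G z)⁻¹ * H z

/-- The Chern curvature `R_{i j̄ k l̄}` of the Hermitian form `G`, as a matrix in `i` and `j`. -/
def curvature (G : C2 → Matrix (Fin 2) (Fin 2) ℂ) (k l : Fin 2) (z : C2) :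
    Matrix (Fin 2) (Fin 2) ℂ :=
  matrixWirtinger k G z * (G z)⁻¹ * matrixWirtingerBar l G z
    - matrixWirtinger k (matrixWirtingerBar l G) z

/-- The second derivative `∇_l̄ ∇_k H` with respect to the Chern connection of the Hermitian
form `G`, expanded in coordinates. -/
def covDeriv₂ (G H : C2 → Matrix (Fin 2) (Fin 2) ℂ) (k l : Fin 2) (z : C2) :
    Matrix (Fin 2) (Fin 2) ℂ :=
  matrixWirtinger k (matrixWirtingerBar l H) z + curvature G k l z * (G z)⁻¹ * H z
    - matrixWirtinger k G z * (G z)⁻¹ * matrixWirtingerBar l H z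
    - covDeriv G H k z * (G z)⁻¹ * matrixWirtingerBar l G z

variable {G H : C2 → Matrix (Fin 2) (Fin 2) ℂ} {T f : C2 → ℂ} {z : C2}

lemma covDeriv_of_eq_one (hGz : G z = 1) (k : Fin 2) :
    covDeriv G H k z = matrixWirtinger k H z - matrixWirtinger k G z * H z := by
  rw [covDeriv, hGz, inv_one, mul_one]

lemma curvature_of_eq_one (hGz : G z = 1) (k l : Fin 2) :
    curvature G k l z = matrixWirtinger k G z * matrixWirtingerBar l G z
      - matrixWirtinger k (matrixWirtingerBar l G) z := by
  rw [curvature, hGz, inv_one, mul_one]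

lemma covDeriv₂_of_eq_one (hGz : G z = 1) (k l : Fin 2) :
    covDeriv₂ G H k l z = matrixWirtinger k (matrixWirtingerBar l H) z + curvature G k l z * H z
      - matrixWirtinger k G z * matrixWirtingerBar l H z
      - covDeriv G H k z * matrixWirtingerBar l G z := by
  rw [covDeriv₂, hGz, inv_one, mul_one, mul_one, mul_one]

section FirstOrder

variable (hG : ∀ i j, DifferentiableAt ℝ (fun w => G w i j) z)
  (hH : ∀ i j, DifferentiableAt ℝ (fun w => H w i j) z) (hGz : G z = 1)
include hG hH hGz

lemma wirtinger_eq_trace_covDeriv (hT : DifferentiableAt ℝ T z)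
    (h : ∀ᶠ w in 𝓝 z, T w * (G w).det = mixedDet (G w) (H w)) (k : Fin 2) :
    wirtinger k T z = (covDeriv G H k z).trace := by
  have hTz : T z = (H z).trace := by simpa [hGz, mixedDet_one_left] using h.self_of_nhds
  rw [wirtinger_of_mul_det_eq hG hG hH hT h hGz, covDeriv_of_eq_one hGz, hTz, hGz,
    mixedDet_one_left]
  simp only [mixedDet, Matrix.trace_fin_two, Matrix.sub_apply, Matrix.mul_apply, Fin.sum_univ_two]
  ring

lemma wirtinger_eq_mixedDet_covDeriv (hf : DifferentiableAt ℝ f z)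
    (h : ∀ᶠ w in 𝓝 z, f w * (G w).det = (H w).det) (k : Fin 2) :
    wirtinger k f z = mixedDet (covDeriv G H k z) (H z) := by
  have hfz : f z = (H z).det := by simpa [hGz] using h.self_of_nhds
  have h₂ : ∀ᶠ w in 𝓝 z, 2 * f w * (G w).det = mixedDet (H w) (H w) :=
    h.mono fun w hw => by rw [mixedDet_self, mul_assoc, hw]
  have hderiv := wirtinger_of_mul_det_eq hG hH hH (hf.const_mul 2) h₂ hGz k
  rw [wirtinger_const_mul, mixedDet_comm (H z), hfz] at hderiv
  rw [covDeriv_of_eq_one hGz]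
  simp only [mixedDet, Matrix.trace_fin_two, Matrix.det_fin_two, Matrix.sub_apply,
    Matrix.mul_apply, Fin.sum_univ_two] at hderiv ⊢
  linear_combination hderiv / 2

end FirstOrder

section SecondOrder

variable (hG : ∀ i j, ContDiffAt ℝ 2 (fun w => G w i j) z)
  (hH : ∀ i j, ContDiffAt ℝ 2 (fun w => H w i j) z) (hGz : G z = 1)
include hG hH hGz

lemma wirtinger_wirtingerBar_eq_trace_covDeriv₂ (hT : ContDiffAt ℝ 2 T z)
    (h : ∀ᶠ w in 𝓝 z, T w * (G w).det = mixedDet (G w) (H w)) (k l : Fin 2) :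
    wirtinger k (wirtingerBar l T) z = (covDeriv₂ G H k l z).trace := by
  have hG₁ (i j) := (hG i j).differentiableAt two_ne_zero
  have hH₁ (i j) := (hH i j).differentiableAt two_ne_zero
  have hT₁ := hT.differentiableAt two_ne_zero
  have hTz : T z = (H z).trace := by simpa [hGz, mixedDet_one_left] using h.self_of_nhds
  rw [wirtinger_wirtingerBar_of_mul_det_eq hG hG hH hT h hGz,
    wirtinger_eq_trace_covDeriv hG₁ hH₁ hGz hT₁ h,
    wirtingerBar_of_mul_det_eq hG₁ hG₁ hH₁ hT₁ h hGz, covDeriv₂_of_eq_one hGz,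
    curvature_of_eq_one hGz, covDeriv_of_eq_one hGz, hTz, hGz, mixedDet_one_left,
    mixedDet_one_left]
  simp only [mixedDet, Matrix.trace_fin_two, Matrix.sub_apply, Matrix.add_apply, Matrix.mul_apply,
    Fin.sum_univ_two]
  ring

lemma wirtinger_wirtingerBar_eq_mixedDet_covDeriv₂ (hf : ContDiffAt ℝ 2 f z)
    (h : ∀ᶠ w in 𝓝 z, f w * (G w).det = (H w).det) (k l : Fin 2) :
    wirtinger k (wirtingerBar l f) z = mixedDet (covDeriv₂ G H k l z) (H z)
      + mixedDet (covDeriv G H k z)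
        (matrixWirtingerBar l H z - H z * matrixWirtingerBar l G z) := by
  have hG₁ (i j) := (hG i j).differentiableAt two_ne_zero
  have hH₁ (i j) := (hH i j).differentiableAt two_ne_zero
  have hf₁ := hf.differentiableAt two_ne_zero
  have hfz : f z = (H z).det := by simpa [hGz] using h.self_of_nhds
  have h₂ : ∀ᶠ w in 𝓝 z, 2 * f w * (G w).det = mixedDet (H w) (H w) :=
    h.mono fun w hw => by rw [mixedDet_self, mul_assoc, hw]
  have hconst : wirtingerBar l (fun w => 2 * f w) = fun w => 2 * wirtingerBar l f w :=
    funext fun w => wirtingerBar_const_mul 2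
  have hderiv := wirtinger_wirtingerBar_of_mul_det_eq hG hH hH (contDiffAt_const.mul hf) h₂ hGz k l
  have hbar := wirtingerBar_of_mul_det_eq hG₁ hH₁ hH₁ (hf₁.const_mul 2) h₂ hGz l
  rw [hbar, hconst, wirtinger_const_mul, wirtinger_const_mul,
    wirtinger_eq_mixedDet_covDeriv hG₁ hH₁ hGz hf₁ h, hfz] at hderiv
  rw [covDeriv₂_of_eq_one hGz, curvature_of_eq_one hGz]
  rw [covDeriv_of_eq_one hGz] at hderiv ⊢
  simp only [mixedDet, Matrix.trace_fin_two, Matrix.det_fin_two, Matrix.sub_apply,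
    Matrix.add_apply, Matrix.mul_apply, Fin.sum_univ_two] at hderiv ⊢
  linear_combination hderiv / 2

end SecondOrder

end CovariantDerivatives

/-- The germ at `z` of a matrix-valued function is that of a closed Hermitian form of type
`(1,1)` and class `C²`. -/
structure IsKahlerAt (G : C2 → Matrix (Fin 2) (Fin 2) ℂ) (z : C2) : Prop where
  contDiffAt : ∀ i j, ContDiffAt ℝ 2 (fun w => G w i j) z
  isHermitian : ∀ᶠ w in 𝓝 z, (G w).IsHermitian
  closed : ∀ᶠ w in 𝓝 z, ∀ i j k, matrixWirtinger k G w i j = matrixWirtinger i G w k j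

namespace IsKahlerAt

variable {G H : C2 → Matrix (Fin 2) (Fin 2) ℂ} {z : C2}

lemma eventually (h : IsKahlerAt G z) : ∀ᶠ w in 𝓝 z, IsKahlerAt G w := by
  have hdiff : ∀ᶠ w in 𝓝 z, ∀ i j, ContDiffAt ℝ 2 (fun x => G x i j) w := by
    simp only [eventually_all]
    exact fun i j => (h.contDiffAt i j).eventually (by simp)
  filter_upwards [hdiff, h.isHermitian.eventually_nhds, h.closed.eventually_nhds] with w h₁ h₂ h₃
  exact ⟨h₁, h₂, h₃⟩

lemma differentiableAt (h : IsKahlerAt G z) (i j : Fin 2) :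
    DifferentiableAt ℝ (fun w => G w i j) z :=
  (h.contDiffAt i j).differentiableAt two_ne_zero

lemma matrixWirtingerBar_eq (h : IsKahlerAt G z) (k : Fin 2) :
    matrixWirtingerBar k G z = (matrixWirtinger k G z).conjTranspose := by
  ext i j
  simp only [matrixWirtingerBar, matrixWirtinger, Matrix.of_apply, Matrix.conjTranspose_apply,
    RCLike.star_def, ← wirtingerBar_conj]
  exact wirtingerBar_congr (h.isHermitian.mono fun w hw => (hw.apply i j).symm)

lemma matrixWirtinger_symm (h : IsKahlerAt G z) (i j k : Fin 2) :
    matrixWirtinger k G z i j = matrixWirtinger i G z k j :=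
  h.closed.self_of_nhds i j k

lemma matrixWirtingerBar_symm (h : IsKahlerAt G z) (i j l : Fin 2) :
    matrixWirtingerBar l G z i j = matrixWirtingerBar j G z i l := by
  rw [h.matrixWirtingerBar_eq, h.matrixWirtingerBar_eq, Matrix.conjTranspose_apply,
    Matrix.conjTranspose_apply, h.matrixWirtinger_symm]

lemma matrixWirtinger_matrixWirtingerBar_symm (h : IsKahlerAt G z) (i j k l : Fin 2) :
    matrixWirtinger k (matrixWirtingerBar l G) z i j
      = matrixWirtinger i (matrixWirtingerBar j G) z k l := by
  have hbar : (fun w => matrixWirtingerBar l G w i j) =ᶠ[𝓝 z]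
      fun w => matrixWirtingerBar j G w i l := by
    filter_upwards [h.eventually] with w hw using hw.matrixWirtingerBar_symm i j l
  calc wirtinger k (fun w => matrixWirtingerBar l G w i j) z
      = wirtinger k (wirtingerBar j fun w => G w i l) z := wirtinger_congr hbar
    _ = wirtingerBar j (fun w => matrixWirtinger k G w i l) z :=
      wirtinger_wirtingerBar_comm (h.contDiffAt i l)
    _ = wirtingerBar j (wirtinger i fun w => G w k l) z :=
      wirtingerBar_congr (h.closed.mono fun w hw => hw i l k)
    _ = wirtinger i (wirtingerBar j fun w => G w k l) z :=
      (wirtinger_wirtingerBar_comm (h.contDiffAt k l)).symm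

lemma add (hG : IsKahlerAt G z) (hH : IsKahlerAt H z) : IsKahlerAt (fun w => G w + H w) z where
  contDiffAt i j := (hG.contDiffAt i j).add (hH.contDiffAt i j)
  isHermitian := by
    filter_upwards [hG.isHermitian, hH.isHermitian] with w hGw hHw using hGw.add hHw
  closed := by
    have hadd {w : C2} (hGw : IsKahlerAt G w) (hHw : IsKahlerAt H w) (i j k : Fin 2) :
        matrixWirtinger k (fun w => G w + H w) w i j
          = matrixWirtinger k G w i j + matrixWirtinger k H w i j :=
      wirtinger_add (hGw.differentiableAt i j) (hHw.differentiableAt i j)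
    filter_upwards [hG.eventually, hH.eventually] with w hGw hHw i j k
    rw [hadd hGw hHw, hadd hGw hHw, hGw.matrixWirtinger_symm, hHw.matrixWirtinger_symm]

lemma covDeriv_symm (hG : IsKahlerAt G z) (hH : IsKahlerAt H z) (i j k : Fin 2) :
    covDeriv G H k z i j = covDeriv G H i z k j := by
  simp only [covDeriv, Matrix.mul_assoc, Matrix.sub_apply,
    Matrix.mul_apply (M := matrixWirtinger _ G z), hH.matrixWirtinger_symm i j k,
    hG.matrixWirtinger_symm i _ k]

lemma curvature_symm (hG : IsKahlerAt G z) (i j k l : Fin 2) :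
    curvature G k l z i j = curvature G i j z k l := by
  simp only [curvature, Matrix.sub_apply, Matrix.mul_apply,
    hG.matrixWirtinger_matrixWirtingerBar_symm i j k l, hG.matrixWirtinger_symm i _ k,
    hG.matrixWirtingerBar_symm _ j l]

lemma conjTranspose_covDeriv (hG : IsKahlerAt G z) (hH : IsKahlerAt H z) (hGz : G z = 1)
    (k : Fin 2) : (covDeriv G H k z).conjTranspose
      = matrixWirtingerBar k H z - H z * matrixWirtingerBar k G z := by
  rw [covDeriv_of_eq_one hGz, hG.matrixWirtingerBar_eq, hH.matrixWirtingerBar_eq,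
    Matrix.conjTranspose_sub, Matrix.conjTranspose_mul, hH.isHermitian.self_of_nhds.eq]

lemma covDeriv₂_sub_covDeriv₂ (hG : IsKahlerAt G z) (hH : IsKahlerAt H z) (hGz : G z = 1)
    {d : Fin 2 → ℂ} (hHz : H z = Matrix.diagonal d) (i j k l : Fin 2) :
    covDeriv₂ G H k l z i j - covDeriv₂ G H i j z k l = (d j - d l) * curvature G k l z i j := by
  simp only [covDeriv₂_of_eq_one hGz, hHz, Matrix.sub_apply, Matrix.add_apply,
    Matrix.mul_diagonal, Matrix.mul_apply (M := matrixWirtinger _ G z),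
    Matrix.mul_apply (M := covDeriv G H _ z), hH.matrixWirtinger_matrixWirtingerBar_symm i j k l,
    hG.matrixWirtinger_symm i _ k, hG.covDeriv_symm hH i _ k, hG.matrixWirtingerBar_symm _ j l,
    hH.matrixWirtingerBar_symm _ j l, hG.curvature_symm i j k l]
  ring

end IsKahlerAt

lemma isKahlerAt_complexHessian {u : C2 → ℝ} {z : C2} (hu : ContDiffAt ℝ 4 u z) :
    IsKahlerAt (complexHessian u) z where
  contDiffAt i j := contDiffAt_wirtinger (m := 2) (n := 3)
    (contDiffAt_wirtingerBar (contDiffAt_ofReal hu) (by norm_num)) (by norm_num)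
  isHermitian := by
    filter_upwards [hu.eventually (by simp)] with w hw
    exact isHermitian_complexHessian (hw.of_le (by norm_num))
  closed := by
    filter_upwards [hu.eventually (by simp)] with w hw i j k
    exact wirtinger_comm (contDiffAt_wirtingerBar (contDiffAt_ofReal hw) (by norm_num))

section LocalEstimate

variable {G H : C2 → Matrix (Fin 2) (Fin 2) ℂ} {z : C2}

/- The left-hand side is the linearised Monge–Ampère operator applied to the trace, minus the
Laplacian of the right-hand side of the equation: the second derivatives of `H` cancel up to
curvature. -/
lemma IsKahlerAt.linearized_trace_sub_laplacian (hG : IsKahlerAt G z) (hH : IsKahlerAt H z)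
    {T f : C2 → ℂ} {a b : ℂ} (hGz : G z = 1) (hHz : H z = Matrix.diagonal ![a, b])
    (hT : ContDiffAt ℝ 2 T z) (hf : ContDiffAt ℝ 2 f z)
    (hTG : ∀ᶠ w in 𝓝 z, T w * (G w).det = mixedDet (G w) (H w))
    (hfG : ∀ᶠ w in 𝓝 z, f w * (G w).det = (H w).det) :
    b * wirtinger 0 (wirtingerBar 0 T) z + a * wirtinger 1 (wirtingerBar 1 T) z
        - ∑ k, wirtinger k (wirtingerBar k f) z
      = (a - b) ^ 2 * curvature G 1 1 z 0 0
        - ∑ k, mixedDet (covDeriv G H k z) (covDeriv G H k z).conjTranspose := by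
  have hcomm := hG.covDeriv₂_sub_covDeriv₂ hH hGz hHz 0 0 1 1
  have hT₂ (k) := wirtinger_wirtingerBar_eq_trace_covDeriv₂ hG.contDiffAt hH.contDiffAt hGz hT
    hTG k k
  have hf₂ (k) := wirtinger_wirtingerBar_eq_mixedDet_covDeriv₂ hG.contDiffAt hH.contDiffAt hGz hf
    hfG k k
  simp only [hT₂, hf₂, hG.conjTranspose_covDeriv hH hGz, hHz, mixedDet_diagonal, Fin.sum_univ_two,
    Matrix.trace_fin_two]
  simp only [Matrix.cons_val_zero, Matrix.cons_val_one] at hcomm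
  linear_combination (a - b) * hcomm

lemma IsKahlerAt.neg_re_le_re_curvature (hG : IsKahlerAt G z) (hGz : G z = 1) (i k : Fin 2) :
    -(matrixWirtinger k (matrixWirtingerBar k G) z i i).re ≤ (curvature G k k z i i).re := by
  rw [curvature_of_eq_one hGz, hG.matrixWirtingerBar_eq, Matrix.sub_apply, Complex.sub_re,
    Matrix.mul_apply, Complex.re_sum]
  have hsq : 0 ≤ ∑ s, (matrixWirtinger k G z i s
      * (matrixWirtinger k G z).conjTranspose s i).re := by
    refine Finset.sum_nonneg fun s _ => ?_
    rw [Matrix.conjTranspose_apply, RCLike.star_def, Complex.mul_conj, Complex.ofReal_re]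
    exact Complex.normSq_nonneg _
  linarith

lemma re_mixedDet_conjTranspose (X : Matrix (Fin 2) (Fin 2) ℂ) :
    (mixedDet X X.conjTranspose).re
      = 2 * (X 0 0 * conj (X 1 1)).re - Complex.normSq (X 0 1) - Complex.normSq (X 1 0) := by
  simp only [mixedDet, Matrix.conjTranspose_apply, RCLike.star_def, Complex.sub_re,
    Complex.add_re, Complex.mul_re, Complex.conj_re, Complex.conj_im, Complex.normSq_apply]
  ring

lemma normSq_add_div_le {a b : ℝ} (ha : 0 < a) (hb : 0 < b) (x v : ℂ) :
    b * Complex.normSq (x + v) / (a + b)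
      ≤ Complex.normSq v - 2 * (x * conj v).re + Complex.normSq (b * x + a * v) / (a * b) := by
  have hdiff : Complex.normSq v - 2 * (x * conj v).re + Complex.normSq (b * x + a * v) / (a * b)
      - b * Complex.normSq (x + v) / (a + b)
      = (b * Complex.normSq (b * x - a * v) + a ^ 2 * (a + b) * Complex.normSq v)
        / (a * b * (a + b)) := by
    simp only [Complex.normSq_apply, Complex.add_re, Complex.add_im, Complex.mul_re,
      Complex.mul_im, Complex.conj_re, Complex.conj_im, Complex.ofReal_re, Complex.ofReal_im,
      Complex.sub_re, Complex.sub_im]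
    field_simp
    ring
  have hnonneg : 0 ≤ (b * Complex.normSq (b * x - a * v) + a ^ 2 * (a + b) * Complex.normSq v)
      / (a * b * (a + b)) := by
    have h₁ := Complex.normSq_nonneg (b * x - a * v)
    have h₂ := Complex.normSq_nonneg v
    positivity
  linarith

/- Only in dimension two: the symmetry of `∇H` turns the off-diagonal entries of one `X k` into
diagonal entries of the other, so the good terms control the mixed products of diagonal entries. -/
lemma sum_normSq_trace_div_le {a b : ℝ} (ha : 0 < a) (hb : 0 < b)
    {X : Fin 2 → Matrix (Fin 2) (Fin 2) ℂ} (hX : ∀ i j k, X k i j = X i k j) :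
    (b * Complex.normSq (X 0).trace + a * Complex.normSq (X 1).trace) / (a + b)
      ≤ (∑ k, Complex.normSq (mixedDet (X k) (Matrix.diagonal ![(a : ℂ), (b : ℂ)]))) / (a * b)
        - ∑ k, (mixedDet (X k) (X k).conjTranspose).re := by
  have h₀ := normSq_add_div_le ha hb (X 0 0 0) (X 0 1 1)
  have h₁ := normSq_add_div_le hb ha (X 1 1 1) (X 1 0 0)
  have hconj : (X 1 1 1 * conj (X 1 0 0)).re = (X 1 0 0 * conj (X 1 1 1)).re := by
    rw [← Complex.conj_re, map_mul, Complex.conj_conj, mul_comm]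
  rw [hconj, add_comm (X 1 1 1), add_comm ((a : ℂ) * X 1 1 1), add_comm b a, mul_comm b a] at h₁
  simp only [mixedDet_diagonal, re_mixedDet_conjTranspose, Fin.sum_univ_two,
    Matrix.trace_fin_two, add_div]
  rw [hX 0 1 1, hX 1 0 0] at *
  linarith [Complex.normSq_nonneg (X 0 0 1), Complex.normSq_nonneg (X 1 1 0)]

lemma re_complexHessian_le_of_isLocalMax {T φ : C2 → ℝ} {lam : ℝ} (hT : ContDiffAt ℝ 2 T z)
    (hφ : ContDiffAt ℝ 2 φ z) (hTz : 0 < T z)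
    (hmax : IsLocalMax (fun w => Real.log (T w) - lam * φ w) z) (k : Fin 2) :
    (complexHessian T z k k).re ≤ lam * T z * (complexHessian φ z k k).re
      + Complex.normSq (wirtinger k (fun w => (T w : ℂ)) z) / T z := by
  have hlog : ContDiffAt ℝ 2 (fun w => Real.log (T w)) z := hT.log hTz.ne'
  have hlamφ : ContDiffAt ℝ 2 (fun w => lam * φ w) z := contDiffAt_const.mul hφ
  have hneg := re_complexHessian_apply_self_nonpos_of_isLocalMax (i := k) (hlog.sub hlamφ) hmax
  rw [complexHessian_sub hlog hlamφ, Matrix.sub_apply, complexHessian_log hT hTz.ne',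
    complexHessian_const_mul, wirtingerBar_ofReal, Complex.mul_conj, Matrix.smul_apply,
    smul_eq_mul, ← Complex.ofReal_pow, ← Complex.ofReal_div, Complex.sub_re, Complex.sub_re,
    Complex.div_ofReal_re, Complex.ofReal_re, Complex.re_ofReal_mul] at hneg
  field_simp at hneg ⊢
  linarith

lemma IsKahlerAt.le_re_linearized_trace (hG : IsKahlerAt G z) (hH : IsKahlerAt H z)
    {T f : C2 → ℝ} {a b C : ℝ} (hGz : G z = 1)
    (hHz : H z = Matrix.diagonal ![(a : ℂ), (b : ℂ)]) (ha : 0 < a) (hb : 0 < b)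
    (hT : ContDiffAt ℝ 2 T z) (hf : ContDiffAt ℝ 2 f z)
    (hTG : ∀ᶠ w in 𝓝 z, (T w : ℂ) * (G w).det = mixedDet (G w) (H w))
    (hfG : ∀ᶠ w in 𝓝 z, (f w : ℂ) * (G w).det = (H w).det)
    (hcurv : (matrixWirtinger 1 (matrixWirtingerBar 1 G) z 0 0).re ≤ C) (hC : 0 ≤ C) :
    (∑ k, (complexHessian f z k k).re) - C * (a + b) ^ 2
        + (b * Complex.normSq (wirtinger 0 (fun w => (T w : ℂ)) z)
          + a * Complex.normSq (wirtinger 1 (fun w => (T w : ℂ)) z)) / (a + b)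
        - (∑ k, Complex.normSq (wirtinger k (fun w => (f w : ℂ)) z)) / (a * b)
      ≤ b * (complexHessian T z 0 0).re + a * (complexHessian T z 1 1).re := by
  have hT' := contDiffAt_ofReal hT
  have hf' := contDiffAt_ofReal hf
  have hgrad := sum_normSq_trace_div_le ha hb (hG.covDeriv_symm hH)
  have hT₁ (k) := wirtinger_eq_trace_covDeriv hG.differentiableAt hH.differentiableAt hGz
    (hT'.differentiableAt two_ne_zero) hTG k
  have hf₁ (k) := wirtinger_eq_mixedDet_covDeriv hG.differentiableAt hH.differentiableAt hGz
    (hf'.differentiableAt two_ne_zero) hfG k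
  simp only [← hHz, ← hT₁, ← hf₁] at hgrad
  have hcurvature : -(C * (a + b) ^ 2) ≤ (a - b) ^ 2 * (curvature G 1 1 z 0 0).re := by
    nlinarith [hG.neg_re_le_re_curvature hGz 0 1, mul_nonneg hC (mul_nonneg ha.le hb.le),
      sq_nonneg (a - b)]
  have hlin := congrArg Complex.re
    (hG.linearized_trace_sub_laplacian hH hGz hHz hT' hf' hTG hfG)
  have hcast : ((a : ℂ) - b) ^ 2 = (((a - b) ^ 2 : ℝ) : ℂ) := by norm_cast
  rw [hcast, Complex.sub_re, Complex.sub_re, Complex.add_re, Complex.re_ofReal_mul,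
    Complex.re_ofReal_mul, Complex.re_ofReal_mul, Complex.re_sum, Complex.re_sum] at hlin
  change b * (complexHessian T z 0 0).re + a * (complexHessian T z 1 1).re
    - ∑ k, (complexHessian f z k k).re = _ at hlin
  linarith

theorem IsKahlerAt.sq_trace_le_of_isLocalMax (hG : IsKahlerAt G z) (hH : IsKahlerAt H z)
    {T f φ : C2 → ℝ} {a b lam A K C : ℝ} (hGz : G z = 1)
    (hHz : H z = Matrix.diagonal ![(a : ℂ), (b : ℂ)]) (ha : 0 < a) (hb : 0 < b)
    (hT : ContDiffAt ℝ 2 T z) (hf : ContDiffAt ℝ 2 f z) (hφ : ContDiffAt ℝ 2 φ z)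
    (hTG : ∀ᶠ w in 𝓝 z, (T w : ℂ) * (G w).det = mixedDet (G w) (H w))
    (hfG : ∀ᶠ w in 𝓝 z, (f w : ℂ) * (G w).det = (H w).det)
    (hφz : complexHessian φ z = H z - G z)
    (hmax : IsLocalMax (fun w => Real.log (T w) - lam * φ w) z)
    (hlap : -A ≤ ∑ k, (complexHessian f z k k).re)
    (hgrad : ∑ k, Complex.normSq (wirtinger k (fun w => (f w : ℂ)) z) ≤ K * f z)
    (hcurv : (matrixWirtinger 1 (matrixWirtingerBar 1 G) z 0 0).re ≤ C) (hC : 0 ≤ C) :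
    (lam - C) * (a + b) ^ 2 ≤ A + K + 2 * lam * (a * b) * (a + b) := by
  have hTz : T z = a + b := by
    have h := hTG.self_of_nhds
    simp only [hGz, hHz, mixedDet_one_left, Matrix.trace_diagonal, Fin.sum_univ_two,
      Matrix.det_one, mul_one, Matrix.cons_val_zero, Matrix.cons_val_one] at h
    exact_mod_cast h
  have hfz : f z = a * b := by
    have h := hfG.self_of_nhds
    simp only [hGz, hHz, Matrix.det_diagonal, Fin.prod_univ_two, Matrix.det_one, mul_one,
      Matrix.cons_val_zero, Matrix.cons_val_one] at h
    exact_mod_cast h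
  have hlin := hG.le_re_linearized_trace hH hGz hHz ha hb hT hf hTG hfG hcurv hC
  have hgradf : (∑ k, Complex.normSq (wirtinger k (fun w => (f w : ℂ)) z)) / (a * b) ≤ K := by
    rwa [div_le_iff₀ (mul_pos ha hb), ← hfz]
  have hφa : (complexHessian φ z 0 0).re = a - 1 := by simp [hφz, hHz, hGz]
  have hφb : (complexHessian φ z 1 1).re = b - 1 := by simp [hφz, hHz, hGz]
  have hsecond (k) := re_complexHessian_le_of_isLocalMax hT hφ (by rw [hTz]; positivity) hmax k
  have h₀ := mul_le_mul_of_nonneg_left (hsecond 0) hb.le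
  have h₁ := mul_le_mul_of_nonneg_left (hsecond 1) ha.le
  rw [hφa, hTz, mul_add, ← mul_div_assoc] at h₀
  rw [hφb, hTz, mul_add, ← mul_div_assoc] at h₁
  rw [add_div] at hlin
  linarith

end LocalEstimate

section HermitianForms

variable {E ι : Type*} [AddCommGroup E] [Module ℂ E]

lemma I_smul_I_smul (v : E) : Complex.I • Complex.I • v = -v := by
  rw [smul_smul, Complex.I_mul_I, neg_one_smul]

variable [Module ℝ E] {B : E →ₗ[ℝ] E →ₗ[ℝ] ℝ}

/-- The sesquilinear form `h(v, w) = (1/2) (B(v, w) + √-1 B(v, √-1 w))` attached to a real bilinear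
form `B`. The normalisation is the one for which `h(∂/∂xⁱ, ∂/∂xʲ) = B(∂/∂zⁱ, ∂/∂z̄ʲ)` when `B` is
invariant under multiplication by `√-1`. -/
def hermForm (B : E →ₗ[ℝ] E →ₗ[ℝ] ℝ) (v w : E) : ℂ :=
  (1 / 2) * ((B v w : ℂ) + Complex.I * (B v (Complex.I • w) : ℂ))

lemma hermForm_add_left (v v' w : E) :
    hermForm B (v + v') w = hermForm B v w + hermForm B v' w := by
  simp only [hermForm, map_add, LinearMap.add_apply, Complex.ofReal_add]
  ring

lemma form_I_smul_left (hB : ∀ v w, B (Complex.I • v) (Complex.I • w) = B v w) (v w : E) :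
    B (Complex.I • v) w = -B v (Complex.I • w) := by
  rw [← hB (Complex.I • v) w, I_smul_I_smul, map_neg, LinearMap.neg_apply]

lemma conj_hermForm (hB : ∀ v w, B (Complex.I • v) (Complex.I • w) = B v w)
    (hsymm : ∀ v w, B v w = B w v) (v w : E) : conj (hermForm B v w) = hermForm B w v := by
  have hI : B w (Complex.I • v) = -B v (Complex.I • w) := by
    rw [hsymm, form_I_smul_left hB]
  simp only [hermForm, map_mul, map_add, map_div₀, map_one, map_ofNat, Complex.conj_ofReal,
    Complex.conj_I, hI, hsymm w v, Complex.ofReal_neg]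
  ring

lemma hermForm_self (hB : ∀ v w, B (Complex.I • v) (Complex.I • w) = B v w)
    (hsymm : ∀ v w, B v w = B w v) (v : E) : hermForm B v v = ((1 / 2 * B v v : ℝ) : ℂ) := by
  have hI := form_I_smul_left hB v v
  rw [hsymm] at hI
  rw [hermForm, self_eq_neg.1 hI]
  push_cast
  ring

variable [IsScalarTower ℝ ℂ E]

lemma smul_eq_re_smul_add_im_smul (c : ℂ) (v : E) :
    c • v = c.re • v + c.im • (Complex.I • v) := by
  conv_lhs => rw [← Complex.re_add_im c]
  rw [add_smul, mul_smul, ← algebraMap_smul ℂ c.re v, ← algebraMap_smul ℂ c.im (Complex.I • v)]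
  rfl

lemma hermForm_smul_left (hB : ∀ v w, B (Complex.I • v) (Complex.I • w) = B v w) (c : ℂ)
    (v w : E) : hermForm B (c • v) w = c * hermForm B v w := by
  rw [smul_eq_re_smul_add_im_smul]
  conv_rhs => rw [← Complex.re_add_im c]
  simp only [hermForm, map_add, map_smul, LinearMap.add_apply, LinearMap.smul_apply, smul_eq_mul,
    form_I_smul_left hB, I_smul_I_smul, map_neg, Complex.ofReal_add, Complex.ofReal_mul,
    Complex.ofReal_neg]
  linear_combination (-(1 / 2) * (c.im : ℂ) * B v (Complex.I • w)) * Complex.I_sq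

lemma hermForm_sum_smul_left (hB : ∀ v w, B (Complex.I • v) (Complex.I • w) = B v w)
    (s : Finset ι) (c : ι → ℂ) (v : ι → E) (w : E) :
    hermForm B (∑ i ∈ s, c i • v i) w = ∑ i ∈ s, c i * hermForm B (v i) w := by
  classical
  induction s using Finset.induction_on with
  | empty => simp [hermForm]
  | insert i s hi ih =>
    rw [Finset.sum_insert hi, Finset.sum_insert hi, hermForm_add_left, hermForm_smul_left hB, ih]

lemma hermForm_sum_smul_right (hB : ∀ v w, B (Complex.I • v) (Complex.I • w) = B v w)
    (hsymm : ∀ v w, B v w = B w v) (s : Finset ι) (c : ι → ℂ) (v : E) (w : ι → E) :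
    hermForm B v (∑ i ∈ s, c i • w i) = ∑ i ∈ s, conj (c i) * hermForm B v (w i) := by
  rw [← conj_hermForm hB hsymm, hermForm_sum_smul_left hB, map_sum]
  simp only [map_mul, conj_hermForm hB hsymm]

lemma posDef_hermForm [Finite ι] (hB : ∀ v w, B (Complex.I • v) (Complex.I • w) = B v w)
    (hsymm : ∀ v w, B v w = B w v) (hpos : ∀ v, v ≠ 0 → 0 < B v v) {v : ι → E}
    (hv : LinearIndependent ℂ v) : (Matrix.of fun i j => hermForm B (v i) (v j)).PosDef := by
  cases nonempty_fintype ι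
  refine Matrix.PosDef.of_dotProduct_mulVec_pos ?_ fun x hx => ?_
  · ext i j
    exact conj_hermForm hB hsymm _ _
  have hne : ∑ i, conj (x i) • v i ≠ 0 := fun h => hx <| funext fun i => by
    simpa using Fintype.linearIndependent_iff.1 hv _ h i
  have hself : star x ⬝ᵥ (Matrix.of fun i j => hermForm B (v i) (v j)).mulVec x
      = hermForm B (∑ i, conj (x i) • v i) (∑ i, conj (x i) • v i) := by
    simp only [hermForm_sum_smul_left hB, hermForm_sum_smul_right hB hsymm, Complex.conj_conj,
      dotProduct, Matrix.mulVec, Matrix.of_apply, Pi.star_apply, RCLike.star_def, mul_comm]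
  rw [hself, hermForm_self hB hsymm]
  exact_mod_cast mul_pos one_half_pos (hpos _ hne)

end HermitianForms

section Charts

lemma eventuallyEq_transition {M X : Type*} [TopologicalSpace M]
    {e e' : OpenPartialHomeomorph M C2} {z : C2} (hz : z ∈ e'.target)
    (hz' : e'.symm z ∈ e.source) (u : M → X) :
    u ∘ e'.symm =ᶠ[𝓝 z] (u ∘ e.symm) ∘ (e ∘ e'.symm) := by
  filter_upwards [(e'.continuousAt_symm hz).eventually (e.open_source.mem_nhds hz')] with w hw
  simp only [Function.comp_apply, e.left_inv hw]

variable {M : Type*} [TopologicalSpace M] [ChartedSpace C2 M]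

/-- The holomorphic coordinate systems of a complex surface. -/
abbrev holomorphicAtlas (M : Type*) [TopologicalSpace M] [ChartedSpace C2 M] :
    Set (OpenPartialHomeomorph M C2) :=
  IsManifold.maximalAtlas 𝓘(ℂ, C2) ω M

variable {e e' e'' : OpenPartialHomeomorph M C2} {z : C2}

lemma mem_contDiffGroupoid_real {t : OpenPartialHomeomorph C2 C2}
    (ht : t ∈ contDiffGroupoid ω 𝓘(ℂ, C2)) : t ∈ contDiffGroupoid ∞ 𝓘(ℝ, C2) := by
  rw [contDiffGroupoid, mem_groupoid_of_pregroupoid] at ht ⊢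
  have hto : ContDiffOn ℂ ω _ _ := ht.1
  have hinv : ContDiffOn ℂ ω _ _ := ht.2
  exact ⟨(hto.of_le le_top).restrict_scalars ℝ, (hinv.of_le le_top).restrict_scalars ℝ⟩

lemma mem_maximalAtlas_real (he : e ∈ holomorphicAtlas M) :
    e ∈ IsManifold.maximalAtlas 𝓘(ℝ, C2) ∞ M := by
  rw [IsManifold.mem_maximalAtlas_iff] at he ⊢
  exact fun e₁ he₁ =>
    ⟨mem_contDiffGroupoid_real (he e₁ he₁).1, mem_contDiffGroupoid_real (he e₁ he₁).2⟩

lemma contMDiffAt_symm (he : e ∈ holomorphicAtlas M) (hz : z ∈ e.target) :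
    ContMDiffAt 𝓘(ℝ, C2) 𝓘(ℝ, C2) ∞ e.symm z :=
  contMDiffAt_symm_of_mem_maximalAtlas (mem_maximalAtlas_real he) hz

lemma mfderiv_symm_line (he : e ∈ holomorphicAtlas M) {v : C2} {t : ℝ}
    (ht : z + t • v ∈ e.target) :
    mfderiv 𝓘(ℝ, ℝ) 𝓘(ℝ, C2) (fun s : ℝ => e.symm (z + s • v)) t 1
      = coordVector e (z + t • v) v := by
  have hcomp := ((contMDiffAt_symm he ht).mdifferentiableAt (by simp)).hasMFDerivAt.comp
    t (hasDerivAt_add_smul z v t).hasFDerivAt.hasMFDerivAt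
  exact (DFunLike.congr_fun hcomp.mfderiv 1).trans
    (congrArg (mfderiv 𝓘(ℝ, C2) 𝓘(ℝ, C2) e.symm (z + t • v)) (one_smul ℝ v))

lemma contDiffAt_comp_symm {u : M → ℝ} {n : ℕ∞} (hu : ContMDiff 𝓘(ℝ, C2) 𝓘(ℝ, ℝ) n u)
    (he : e ∈ holomorphicAtlas M) (hz : z ∈ e.target) : ContDiffAt ℝ n (u ∘ e.symm) z :=
  (hu.contMDiffAt.comp z ((contMDiffAt_symm he hz).of_le (by exact_mod_cast le_top))).contDiffAt

lemma contDiffAt_transition (he : e ∈ holomorphicAtlas M) (he' : e' ∈ holomorphicAtlas M)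
    (hz : z ∈ e'.target) (hz' : e'.symm z ∈ e.source) : ContDiffAt ℂ ω (e ∘ e'.symm) z := by
  have h := IsManifold.compatible_of_mem_maximalAtlas he' he
  rw [contDiffGroupoid, mem_groupoid_of_pregroupoid] at h
  have hon : ContDiffOn ℂ ω (e ∘ e'.symm) (e'.symm.trans e).source := by
    simpa [contDiffPregroupoid] using h.1
  exact hon.contDiffAt ((e'.symm.trans e).open_source.mem_nhds (by simp [hz, hz']))

lemma fderiv_transition_comp (he : e ∈ holomorphicAtlas M) (he' : e' ∈ holomorphicAtlas M)
    (he'' : e'' ∈ holomorphicAtlas M) (hz : z ∈ e''.target) (hz' : e''.symm z ∈ e'.source)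
    (hz'' : e''.symm z ∈ e.source) (v : C2) :
    fderiv ℂ (e ∘ e''.symm) z v
      = fderiv ℂ (e ∘ e'.symm) (e' (e''.symm z)) (fderiv ℂ (e' ∘ e''.symm) z v) := by
  have hinner : DifferentiableAt ℂ (e' ∘ e''.symm) z :=
    (contDiffAt_transition he' he'' hz hz').differentiableAt (by simp)
  have houter : DifferentiableAt ℂ (e ∘ e'.symm) ((e' ∘ e''.symm) z) :=
    (contDiffAt_transition he he' (e'.map_source hz')
      (by simpa only [e'.left_inv hz'] using hz'')).differentiableAt (by simp)
  rw [(eventuallyEq_transition hz hz' e).fderiv_eq, fderiv_comp z houter hinner]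
  rfl

lemma fderiv_transition_self {X : Type*} [TopologicalSpace X] {e : OpenPartialHomeomorph X C2}
    (hz : z ∈ e.target) (v : C2) : fderiv ℂ (e ∘ e.symm) z v = v := by
  have hid : e ∘ e.symm =ᶠ[𝓝 z] id := by
    filter_upwards [e.open_target.mem_nhds hz] with w hw using e.right_inv hw
  rw [hid.fderiv_eq, fderiv_id, ContinuousLinearMap.id_apply]

lemma complexHessian_transition {u : M → ℝ} (he : e ∈ holomorphicAtlas M)
    (he' : e' ∈ holomorphicAtlas M) (hz : z ∈ e'.target) (hz' : e'.symm z ∈ e.source)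
    (hu : ContDiffAt ℝ 2 (u ∘ e.symm) (e (e'.symm z))) :
    complexHessian (u ∘ e'.symm) z
      = inFrame (jacobian (e ∘ e'.symm) z) (complexHessian (u ∘ e.symm) (e (e'.symm z))) := by
  have hu' : (fun w => ((u ∘ e'.symm) w : ℂ)) =ᶠ[𝓝 z]
      fun w => (((u ∘ e.symm) ∘ (e ∘ e'.symm)) w : ℂ) :=
    (eventuallyEq_transition hz hz' u).fun_comp ((↑) : ℝ → ℂ)
  rw [show e (e'.symm z) = (e ∘ e'.symm) z from rfl,
    ← complexHessian_comp ((contDiffAt_transition he he' hz hz').of_le le_top) hu]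
  ext i j
  exact wirtinger_congr (eventuallyEq_wirtingerBar hu')

variable [IsManifold 𝓘(ℂ, C2) ω M]

lemma coordVector_eq (he : e ∈ holomorphicAtlas M) (hz : z ∈ e.target) (v : C2) :
    coordVector e z v = (fderiv ℂ (chartAt C2 (e.symm z) ∘ e.symm) z v : C2) := by
  have hdiff : DifferentiableAt ℂ (chartAt C2 (e.symm z) ∘ e.symm) z :=
    (contDiffAt_transition (IsManifold.chart_mem_maximalAtlas _) he hz
      (mem_chart_source _ _)).differentiableAt (by simp)
  have hmfderiv : HasMFDerivAt 𝓘(ℝ, C2) 𝓘(ℝ, C2) e.symm z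
      ((fderiv ℂ (chartAt C2 (e.symm z) ∘ e.symm) z).restrictScalars ℝ) := by
    refine ⟨(contMDiffAt_symm he hz).continuousAt, ?_⟩
    rw [ModelWithCorners.range_eq_univ]
    exact (hdiff.hasFDerivAt.restrictScalars ℝ).hasFDerivWithinAt
  rw [coordVector, hmfderiv.mfderiv]
  rfl

lemma coordVector_I_smul (he : e ∈ holomorphicAtlas M) (hz : z ∈ e.target) (v : C2) :
    coordVector e z (Complex.I • v) = tangentJ _ (coordVector e z v) := by
  rw [coordVector_eq he hz, coordVector_eq he hz, map_smul]
  rfl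

lemma coordVector_ne_zero (he : e ∈ holomorphicAtlas M) (hz : z ∈ e.target) {v : C2}
    (hv : v ≠ 0) : coordVector e z v ≠ 0 := by
  intro h
  rw [coordVector_eq he hz] at h
  refine hv ?_
  rw [← fderiv_transition_self hz v, fderiv_transition_comp he
    (IsManifold.chart_mem_maximalAtlas (e.symm z)) he hz (mem_chart_source _ _) (e.map_target hz),
    show fderiv ℂ (chartAt C2 (e.symm z) ∘ e.symm) z v = 0 from h, map_zero]

end Charts

section Metric

variable {M : Type*} [TopologicalSpace M] [ChartedSpace C2 M] [IsManifold 𝓘(ℂ, C2) ω M]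
  {g : KahlerMetric M} {e e' : OpenPartialHomeomorph M C2} {z : C2}

/-- The metric as a field of real bilinear forms on `ℂ²`, in the coordinates `e`. -/
def KahlerMetric.form (g : KahlerMetric M) (e : OpenPartialHomeomorph M C2) (z : C2) :
    C2 →ₗ[ℝ] C2 →ₗ[ℝ] ℝ :=
  ((g.inner (e.symm z)).toLinearMap₁₂).compl₁₂
    (mfderiv 𝓘(ℝ, C2) 𝓘(ℝ, C2) e.symm z).toLinearMap
    (mfderiv 𝓘(ℝ, C2) 𝓘(ℝ, C2) e.symm z).toLinearMap

lemma KahlerMetric.form_apply (v w : C2) :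
    g.form e z v w = g.inner (e.symm z) (coordVector e z v) (coordVector e z w) := rfl

lemma KahlerMetric.form_symm (v w : C2) : g.form e z v w = g.form e z w v :=
  g.symm _ _ _

lemma KahlerMetric.form_I_smul (he : e ∈ holomorphicAtlas M) (hz : z ∈ e.target) (v w : C2) :
    g.form e z (Complex.I • v) (Complex.I • w) = g.form e z v w := by
  rw [form_apply, form_apply, coordVector_I_smul he hz, coordVector_I_smul he hz, g.hermitian]

lemma KahlerMetric.form_pos (he : e ∈ holomorphicAtlas M) (hz : z ∈ e.target) (v : C2)
    (hv : v ≠ 0) : 0 < g.form e z v v :=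
  g.pos _ _ (coordVector_ne_zero he hz hv)

lemma KahlerMetric.form_transition (he : e ∈ holomorphicAtlas M) (he' : e' ∈ holomorphicAtlas M)
    (hz : z ∈ e'.target) (hz' : e'.symm z ∈ e.source) (v w : C2) :
    g.form e' z v w = g.form e (e (e'.symm z)) (fderiv ℂ (e ∘ e'.symm) z v)
      (fderiv ℂ (e ∘ e'.symm) z w) := by
  have hinner {p q : M} (hpq : p = q) (v w : C2) : g.inner p v w = g.inner q v w := by
    subst hpq
    rfl
  have hchart := IsManifold.chart_mem_maximalAtlas (I := 𝓘(ℂ, C2)) (n := ω) (e'.symm z)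
  rw [form_apply, form_apply, coordVector_eq he (e.map_source hz'),
    coordVector_eq he (e.map_source hz'), coordVector_eq he' hz, coordVector_eq he' hz,
    fderiv_transition_comp hchart he he' hz hz' (mem_chart_source _ _),
    fderiv_transition_comp hchart he he' hz hz' (mem_chart_source _ _)]
  refine (hinner (e.left_inv hz').symm _ _).trans ?_
  rw [e.left_inv hz']

lemma coordMatrix_apply_eq_hermForm (he : e ∈ holomorphicAtlas M) (hz : z ∈ e.target)
    (i j : Fin 2) : coordMatrix g.inner e z i j = hermForm (g.form e z) (dx i) (dx j) := by
  have hB := g.form_I_smul he hz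
  simp only [coordMatrix, Matrix.of_apply, ← KahlerMetric.form_apply, hermForm,
    dy_eq_I_smul_dx, hB, form_I_smul_left hB]
  push_cast
  ring

lemma linearIndependent_dx : LinearIndependent ℂ dx := by
  refine Fintype.linearIndependent_iff.2 fun c hc i => ?_
  simpa [sum_smul_dx] using congrArg (fun v : C2 => v i)
    ((sum_smul_dx (WithLp.toLp 2 c)).symm.trans hc)

lemma KahlerMetric.posDef_coordMatrix (g : KahlerMetric M) (he : e ∈ holomorphicAtlas M)
    (hz : z ∈ e.target) : (coordMatrix g.inner e z).PosDef := by
  convert posDef_hermForm (g.form_I_smul he hz) g.form_symm (g.form_pos he hz)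
    linearIndependent_dx using 1
  ext i j
  exact coordMatrix_apply_eq_hermForm he hz i j

lemma KahlerMetric.det_coordMatrix_ne_zero (g : KahlerMetric M) (he : e ∈ holomorphicAtlas M)
    (hz : z ∈ e.target) : (coordMatrix g.inner e z).det ≠ 0 :=
  (g.posDef_coordMatrix he hz).det_pos.ne'

lemma KahlerMetric.coordMatrix_transition (g : KahlerMetric M) (he : e ∈ holomorphicAtlas M)
    (he' : e' ∈ holomorphicAtlas M) (hz : z ∈ e'.target) (hz' : e'.symm z ∈ e.source) :
    coordMatrix g.inner e' z
      = inFrame (jacobian (e ∘ e'.symm) z) (coordMatrix g.inner e (e (e'.symm z))) := by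
  have hB := g.form_I_smul he (e.map_source hz')
  ext i j
  have hpull : hermForm (g.form e' z) (dx i) (dx j) = hermForm (g.form e (e (e'.symm z)))
      (fderiv ℂ (e ∘ e'.symm) z (dx i)) (fderiv ℂ (e ∘ e'.symm) z (dx j)) := by
    simp only [hermForm, g.form_transition he he' hz hz', map_smul]
  rw [coordMatrix_apply_eq_hermForm he' hz, hpull, inFrame_apply,
    ← sum_smul_dx (fderiv ℂ (e ∘ e'.symm) z (dx i)),
    ← sum_smul_dx (fderiv ℂ (e ∘ e'.symm) z (dx j)), hermForm_sum_smul_left hB]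
  refine Finset.sum_congr rfl fun r _ => ?_
  rw [hermForm_sum_smul_right hB g.form_symm, Finset.mul_sum]
  refine Finset.sum_congr rfl fun s _ => ?_
  rw [coordMatrix_apply_eq_hermForm he (e.map_source hz'), jacobian, Matrix.of_apply,
    Matrix.of_apply]
  ring

lemma trace_inv_mul_inFrame {n : Type*} [Fintype n] [DecidableEq n] {G H P : Matrix n n ℂ}
    (h : IsUnit (inFrame P G).det) :
    ((inFrame P G)⁻¹ * inFrame P H).trace = (G⁻¹ * H).trace := by
  simp only [inFrame, Matrix.det_mul] at h ⊢
  have hP : IsUnit P.transpose.det := isUnit_of_mul_isUnit_left (isUnit_of_mul_isUnit_left h)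
  have hP' : IsUnit (P.map conj).det := isUnit_of_mul_isUnit_right h
  calc _ = ((P.map conj)⁻¹ * (G⁻¹ * (P.transpose⁻¹ * P.transpose) * H * P.map conj)).trace := by
        simp only [Matrix.mul_inv_rev, Matrix.mul_assoc]
    _ = (G⁻¹ * H * (P.map conj * (P.map conj)⁻¹)).trace := by
        rw [Matrix.nonsing_inv_mul _ hP, Matrix.mul_one, Matrix.trace_mul_comm, Matrix.mul_assoc]
    _ = (G⁻¹ * H).trace := by rw [Matrix.mul_nonsing_inv _ hP', Matrix.mul_one]

lemma KahlerMetric.laplacian_eq {u : M → ℝ} (he : e ∈ holomorphicAtlas M) (hz : z ∈ e.target)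
    (hu : ContDiffAt ℝ 2 (u ∘ e.symm) z) :
    g.laplacian u (e.symm z)
      = (((coordMatrix g.inner e z)⁻¹ * complexHessian (u ∘ e.symm) z).trace).re := by
  obtain ⟨p, hp, rfl⟩ := e.surjOn hz
  have hc : chartAt C2 p ∈ holomorphicAtlas M := IsManifold.chart_mem_maximalAtlas p
  have hcp := (chartAt C2 p).map_source (mem_chart_source C2 p)
  have hinv := (chartAt C2 p).left_inv (mem_chart_source C2 p)
  have hG := g.coordMatrix_transition he hc hcp (by rwa [hinv])
  have hH := complexHessian_transition he hc hcp (by rwa [hinv]) (by rwa [hinv])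
  rw [e.left_inv hp, laplacian, matrix, hessianMatrix, hG, hH,
    trace_inv_mul_inFrame (hG ▸ (g.det_coordMatrix_ne_zero hc hcp).isUnit), hinv]

end Metric

section Smoothness

variable {M : Type*} [TopologicalSpace M] [ChartedSpace C2 M] [IsManifold 𝓘(ℂ, C2) ω M]
  {e : OpenPartialHomeomorph M C2} {z : C2}

lemma contMDiffAt_coordVector (he : e ∈ holomorphicAtlas M) (hz : z ∈ e.target) (v : C2) :
    ContMDiffAt 𝓘(ℝ, C2) (𝓘(ℝ, C2).prod 𝓘(ℝ, C2)) ∞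
      (fun w => (⟨e.symm w, coordVector e w v⟩ : TangentBundle 𝓘(ℝ, C2) M)) z := by
  have hsymm : ContMDiffOn 𝓘(ℝ, C2) 𝓘(ℝ, C2) ∞ e.symm e.target :=
    contMDiffOn_symm_of_mem_maximalAtlas (mem_maximalAtlas_real he)
  have htangent := hsymm.contMDiffOn_tangentMapWithin (m := ∞) le_rfl e.open_target.uniqueMDiffOn
  have hconst : ContMDiffAt 𝓘(ℝ, C2) (𝓘(ℝ, C2).prod 𝓘(ℝ, C2)) ∞
      (fun w => (⟨w, v⟩ : TangentBundle 𝓘(ℝ, C2) C2)) z :=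
    contMDiffAt_vectorSpace_iff_contDiffAt.2 contDiffAt_const
  have hcomp := (htangent.contMDiffAt (x := (⟨z, v⟩ : TangentBundle 𝓘(ℝ, C2) C2))
    ((e.open_target.preimage
      (FiberBundle.continuous_proj C2 (TangentSpace 𝓘(ℝ, C2)))).mem_nhds hz)).comp z hconst
  refine hcomp.congr_of_eventuallyEq ?_
  filter_upwards [e.open_target.mem_nhds hz] with w hw
  simp only [Function.comp_apply, tangentMapWithin, coordVector,
    mfderivWithin_of_isOpen e.open_target hw]

lemma KahlerMetric.contDiffAt_form (g : KahlerMetric M) (he : e ∈ holomorphicAtlas M)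
    (hz : z ∈ e.target) (v w : C2) : ContDiffAt ℝ ∞ (fun x => g.form e x v w) z := by
  let _ : Bundle.RiemannianBundle (fun p : M => TangentSpace 𝓘(ℝ, C2) p) :=
    ⟨g.toContMDiffRiemannianMetric.toRiemannianMetric⟩
  exact ((contMDiffAt_coordVector he hz v).inner_bundle
    (contMDiffAt_coordVector he hz w)).contDiffAt

lemma KahlerMetric.contDiffAt_coordMatrix (g : KahlerMetric M) (he : e ∈ holomorphicAtlas M)
    (hz : z ∈ e.target) (i j : Fin 2) :
    ContDiffAt ℝ ∞ (fun x => coordMatrix g.inner e x i j) z := by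
  have hform (v w : C2) := contDiffAt_ofReal (g.contDiffAt_form he hz v w)
  exact contDiffAt_const.mul (((hform (dx i) (dx j)).add (hform (dy i) (dy j))).add
    (contDiffAt_const.mul ((hform (dx i) (dy j)).sub (hform (dy i) (dx j)))))

lemma KahlerMetric.isKahlerAt_coordMatrix (g : KahlerMetric M) (he : e ∈ holomorphicAtlas M)
    (hz : z ∈ e.target) : IsKahlerAt (coordMatrix g.inner e) z where
  contDiffAt i j := (g.contDiffAt_coordMatrix he hz i j).of_le (by norm_cast)
  isHermitian := by
    filter_upwards [e.open_target.mem_nhds hz] with w hw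
    exact (g.posDef_coordMatrix he hw).isHermitian
  closed := by
    filter_upwards [e.open_target.mem_nhds hz] with w hw i j k
    exact g.closed e he w hw i j k

end Smoothness

section Lipschitz

variable {M : Type*} [TopologicalSpace M] [ChartedSpace C2 M] [IsManifold 𝓘(ℂ, C2) ω M]
  {g : KahlerMetric M} {e : OpenPartialHomeomorph M C2} {z : C2}

lemma KahlerMetric.rdist_symm_add_le (he : e ∈ holomorphicAtlas M) {v : C2} {c : ℝ}
    (hseg : ∀ t ∈ Set.Icc (0 : ℝ) 1, z + t • v ∈ e.target ∧ √(g.form e (z + t • v) v v) ≤ c) :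
    g.rdist (e.symm z) (e.symm (z + v)) ≤ ENNReal.ofReal c := by
  let _ : Bundle.RiemannianBundle (fun p : M => TangentSpace 𝓘(ℝ, C2) p) :=
    ⟨g.toContMDiffRiemannianMetric.toRiemannianMetric⟩
  have hline : ContDiff ℝ 1 (fun t : ℝ => z + t • v) := by fun_prop
  have hpath (t : ℝ) (ht : t ∈ Set.Icc (0 : ℝ) 1) :
      ContMDiffAt 𝓘(ℝ, ℝ) 𝓘(ℝ, C2) 1 (fun t : ℝ => e.symm (z + t • v)) t :=
    ((contMDiffAt_symm he (hseg t ht).1).of_le (by norm_cast)).comp t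
      hline.contDiffAt.contMDiffAt
  have hspeed (t : ℝ) (ht : t ∈ Set.Icc (0 : ℝ) 1) :
      ‖mfderiv 𝓘(ℝ, ℝ) 𝓘(ℝ, C2) (fun t : ℝ => e.symm (z + t • v)) t 1‖ₑ ≤ ENNReal.ofReal c := by
    rw [mfderiv_symm_line he (hseg t ht).1, ← ofReal_norm, norm_eq_sqrt_real_inner]
    exact ENNReal.ofReal_le_ofReal (hseg t ht).2
  calc g.rdist (e.symm z) (e.symm (z + v))
      ≤ Manifold.pathELength 𝓘(ℝ, C2) (fun t : ℝ => e.symm (z + t • v)) 0 1 :=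
        Manifold.riemannianEDist_le_pathELength (fun t ht => (hpath t ht).contMDiffWithinAt)
          (by simp) (by simp) zero_le_one
    _ ≤ ∫⁻ _ in Set.Icc (0 : ℝ) 1, ENNReal.ofReal c := by
        rw [Manifold.pathELength_eq_lintegral_mfderiv_Icc]
        exact MeasureTheory.setLIntegral_mono' measurableSet_Icc hspeed
    _ = ENNReal.ofReal c := by simp

lemma KahlerMetric.eventually_rdist_symm_add_smul_le (he : e ∈ holomorphicAtlas M)
    (hz : z ∈ e.target) {v : C2} {c : ℝ} (hc : √(g.form e z v v) < c) :
    ∀ᶠ t : ℝ in 𝓝 0, g.rdist (e.symm z) (e.symm (z + t • v)) ≤ ENNReal.ofReal (c * |t|) := by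
  have hnear : ∀ᶠ w in 𝓝 z, w ∈ e.target ∧ √(g.form e w v v) < c :=
    (e.open_target.eventually_mem hz).and
      ((g.contDiffAt_form he hz v v).continuousAt.sqrt.eventually_lt_const hc)
  have hline : Tendsto (fun t : ℝ => z + t • v) (𝓝 0) (𝓝 z) :=
    (by fun_prop : Continuous fun t : ℝ => z + t • v).tendsto' 0 z (by simp)
  obtain ⟨δ, hδ, hball⟩ := Metric.eventually_nhds_iff.1 (hline.eventually hnear)
  filter_upwards [Metric.ball_mem_nhds (0 : ℝ) hδ] with t ht
  refine KahlerMetric.rdist_symm_add_le he fun s hs => ?_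
  have hst : dist (s * t) 0 < δ := by
    rw [dist_zero_right, norm_mul, Real.norm_of_nonneg hs.1]
    exact (mul_le_of_le_one_left (norm_nonneg t) hs.2).trans_lt (mem_ball_zero_iff.1 ht)
  obtain ⟨htarget, hform⟩ := hball hst
  rw [smul_smul]
  refine ⟨htarget, ?_⟩
  simp only [map_smul, LinearMap.smul_apply, smul_eq_mul]
  rw [← mul_assoc, Real.sqrt_mul (mul_self_nonneg t), Real.sqrt_mul_self_eq_abs, mul_comm]
  exact mul_le_mul_of_nonneg_right hform.le (abs_nonneg t)

lemma KahlerMetric.IsLipschitz.abs_fderiv_le {L : ℝ≥0} {h : M → ℝ} (hL : g.IsLipschitz L h)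
    (he : e ∈ holomorphicAtlas M) (hz : z ∈ e.target) (hd : DifferentiableAt ℝ (h ∘ e.symm) z)
    (v : C2) : |fderiv ℝ (h ∘ e.symm) z v| ≤ L * √(g.form e z v v) := by
  have hder : HasDerivAt (fun t : ℝ => h (e.symm (z + t • v))) (fderiv ℝ (h ∘ e.symm) z v) 0 :=
    hd.hasFDerivAt.hasLineDerivAt v
  have hbound (c : ℝ) (hc : √(g.form e z v v) < c) : |fderiv ℝ (h ∘ e.symm) z v| ≤ L * c := by
    have hc0 : 0 ≤ c := (Real.sqrt_nonneg _).trans hc.le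
    refine hder.le_of_lip' (by positivity) ?_
    filter_upwards [KahlerMetric.eventually_rdist_symm_add_smul_le he hz hc] with t ht
    have hedist := (hL (e.symm z) (e.symm (z + t • v))).trans (mul_le_mul_right ht L)
    rw [edist_comm, edist_dist, Real.dist_eq, ← ENNReal.ofReal_coe_nnreal,
      ← ENNReal.ofReal_mul L.coe_nonneg, ENNReal.ofReal_le_ofReal_iff (by positivity)] at hedist
    simpa [mul_assoc] using hedist
  have hlim : Tendsto (fun c : ℝ => L * c) (𝓝[>] √(g.form e z v v))
      (𝓝 (L * √(g.form e z v v))) :=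
    (continuous_const_mul (L : ℝ)).continuousWithinAt
  exact ge_of_tendsto hlim (eventually_mem_nhdsWithin.mono hbound)

lemma KahlerMetric.IsLipschitz.sq_fderiv_le {L : ℝ≥0} {f : M → ℝ}
    (hL : g.IsLipschitz L fun p => √(f p)) (he : e ∈ holomorphicAtlas M) (hz : z ∈ e.target)
    (hd : DifferentiableAt ℝ (f ∘ e.symm) z) (hpos : 0 < (f ∘ e.symm) z) (v : C2) :
    (fderiv ℝ (f ∘ e.symm) z v) ^ 2 ≤ 4 * L ^ 2 * (f ∘ e.symm) z * g.form e z v v := by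
  have hsqrt : HasFDerivAt ((fun p => √(f p)) ∘ e.symm)
      ((1 / (2 * √((f ∘ e.symm) z))) • fderiv ℝ (f ∘ e.symm) z) z :=
    hd.hasFDerivAt.sqrt hpos.ne'
  have hle := hL.abs_fderiv_le he hz hsqrt.differentiableAt v
  rw [hsqrt.fderiv, smul_apply, smul_eq_mul, abs_mul,
    abs_of_pos (by positivity), one_div, inv_mul_le_iff₀ (by positivity)] at hle
  have hform : 0 ≤ g.form e z v v := by
    rcases eq_or_ne v 0 with rfl | hv
    · simp
    · exact (KahlerMetric.form_pos he hz v hv).le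
  calc (fderiv ℝ (f ∘ e.symm) z v) ^ 2
      = |fderiv ℝ (f ∘ e.symm) z v| ^ 2 := (sq_abs _).symm
    _ ≤ (2 * √((f ∘ e.symm) z) * (L * √(g.form e z v v))) ^ 2 :=
        pow_le_pow_left₀ (abs_nonneg _) hle 2
    _ = 4 * L ^ 2 * (f ∘ e.symm) z * g.form e z v v := by
        simp only [mul_pow, Real.sq_sqrt hpos.le, Real.sq_sqrt hform]
        ring

lemma KahlerMetric.form_dx_self (he : e ∈ holomorphicAtlas M) (hz : z ∈ e.target) (k : Fin 2) :
    g.form e z (dx k) (dx k) = 2 * (coordMatrix g.inner e z k k).re := by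
  rw [coordMatrix_apply_eq_hermForm he hz,
    hermForm_self (KahlerMetric.form_I_smul he hz) KahlerMetric.form_symm, Complex.ofReal_re]
  ring

lemma KahlerMetric.IsLipschitz.sum_normSq_wirtinger_le {L : ℝ≥0} {f : M → ℝ}
    (hL : g.IsLipschitz L fun p => √(f p)) (he : e ∈ holomorphicAtlas M) (hz : z ∈ e.target)
    (hd : DifferentiableAt ℝ (f ∘ e.symm) z) (hpos : 0 < (f ∘ e.symm) z) :
    ∑ k, Complex.normSq (wirtinger k (fun w => ((f ∘ e.symm) w : ℂ)) z)
      ≤ 4 * L ^ 2 * (coordMatrix g.inner e z).trace.re * (f ∘ e.symm) z := by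
  have hsq (k : Fin 2) : Complex.normSq (wirtinger k (fun w => ((f ∘ e.symm) w : ℂ)) z)
      = ((fderiv ℝ (f ∘ e.symm) z (dx k)) ^ 2 + (fderiv ℝ (f ∘ e.symm) z (dy k)) ^ 2) / 4 := by
    have hparts (x y : ℝ) : Complex.normSq (1 / 2 * (x - Complex.I * y)) = (x ^ 2 + y ^ 2) / 4 := by
      have hform : (1 / 2 * (x - Complex.I * y) : ℂ)
          = ((x / 2 : ℝ) : ℂ) + (-y / 2 : ℝ) * Complex.I := by
        push_cast
        ring
      rw [hform, Complex.normSq_add_mul_I]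
      ring
    rw [wirtinger, fderiv_ofReal_apply hd, fderiv_ofReal_apply hd, hparts]
  rw [Matrix.trace, Complex.re_sum, Finset.mul_sum, Finset.sum_mul]
  refine Finset.sum_le_sum fun k _ => ?_
  have hx := hL.sq_fderiv_le he hz hd hpos (dx k)
  have hy := hL.sq_fderiv_le he hz hd hpos (dy k)
  rw [dy_eq_I_smul_dx, KahlerMetric.form_I_smul he hz, ← dy_eq_I_smul_dx] at hy
  rw [KahlerMetric.form_dx_self he hz] at hx hy
  rw [hsq, Matrix.diag_apply]
  linarith

end Lipschitz

section LinearAlgebra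

variable {n : Type*} [Fintype n] {G H P : Matrix n n ℂ}

lemma inFrame_map_conj (P G : Matrix n n ℂ) : inFrame (P.map conj) G = P.conjTranspose * G * P := by
  have hconj : (P.map conj).map conj = P := Matrix.ext fun i j => Complex.conj_conj (P i j)
  rw [inFrame, hconj]
  rfl

variable [DecidableEq n]

open scoped MatrixOrder in
lemma exists_conjTranspose_mul_mul_eq_one (hG : G.PosDef) :
    ∃ Q : Matrix n n ℂ, IsUnit Q ∧ Q.conjTranspose * G * Q = 1 := by
  obtain ⟨y, hy, hGy⟩ := CStarAlgebra.isStrictlyPositive_iff_eq_star_mul_self.mp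
    hG.isStrictlyPositive
  have hydet : IsUnit y.det := (Matrix.isUnit_iff_isUnit_det y).1 hy
  refine ⟨y⁻¹, Matrix.isUnit_nonsing_inv_iff.2 hy, ?_⟩
  rw [hGy, Matrix.star_eq_conjTranspose, ← Matrix.mul_assoc, ← Matrix.conjTranspose_mul,
    Matrix.mul_nonsing_inv _ hydet, Matrix.conjTranspose_one, Matrix.one_mul,
    Matrix.mul_nonsing_inv _ hydet]

lemma exists_inFrame_eq_one_and_eq_diagonal (hG : G.PosDef) (hH : H.PosDef) :
    ∃ (P : Matrix n n ℂ) (d : n → ℝ), (∀ i, 0 < d i) ∧ inFrame P G = 1 ∧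
      inFrame P H = Matrix.diagonal fun i => (d i : ℂ) := by
  obtain ⟨Q, hQ, hGQ⟩ := exists_conjTranspose_mul_mul_eq_one hG
  have hA := hH.conjTranspose_mul_mul_same (Matrix.mulVec_injective_of_isUnit hQ)
  set U : Matrix n n ℂ := hA.1.eigenvectorUnitary.1
  have hUU : U.conjTranspose * U = 1 := Unitary.coe_star_mul_self hA.1.eigenvectorUnitary
  have hdiag : U.conjTranspose * (Q.conjTranspose * H * Q) * U
      = Matrix.diagonal fun i => (hA.1.eigenvalues i : ℂ) := by
    have h := hA.1.conjStarAlgAut_star_eigenvectorUnitary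
    rwa [Unitary.conjStarAlgAut_star_apply] at h
  have hframe (K : Matrix n n ℂ) : inFrame ((Q * U).map conj) K
      = U.conjTranspose * (Q.conjTranspose * K * Q) * U := by
    rw [inFrame_map_conj, Matrix.conjTranspose_mul]
    simp only [Matrix.mul_assoc]
  refine ⟨(Q * U).map conj, hA.1.eigenvalues, hA.eigenvalues_pos, ?_, (hframe H).trans hdiag⟩
  rw [hframe, hGQ, Matrix.mul_one, hUU]

lemma sq_norm_le_re_trace_inv (h : inFrame P G = 1) (q i : n) : ‖P q i‖ ^ 2 ≤ G⁻¹.trace.re := by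
  have hinv : P.map conj * P.transpose = G⁻¹ := by
    refine (Matrix.inv_eq_left_inv ?_).symm
    rw [Matrix.mul_assoc]
    exact mul_eq_one_comm.1 h
  have htrace : G⁻¹.trace.re = ∑ r, ∑ s, ‖P r s‖ ^ 2 := by
    rw [← hinv, Matrix.trace, Complex.re_sum]
    refine Finset.sum_congr rfl fun r _ => ?_
    rw [Matrix.diag_apply, Matrix.mul_apply, Complex.re_sum]
    refine Finset.sum_congr rfl fun s _ => ?_
    rw [Matrix.map_apply, Matrix.transpose_apply, Complex.conj_mul', ← Complex.ofReal_pow,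
      Complex.ofReal_re]
  rw [htrace]
  exact (Finset.single_le_sum (fun s _ => sq_nonneg ‖P q s‖) (Finset.mem_univ i)).trans
    (Finset.single_le_sum (f := fun r => ∑ s, ‖P r s‖ ^ 2)
      (fun r _ => Finset.sum_nonneg fun s _ => sq_nonneg _) (Finset.mem_univ q))

lemma ofReal_re_trace_inv_mul (hG : G.IsHermitian) (hH : H.IsHermitian) :
    ((G⁻¹ * H).trace.re : ℂ) = (G⁻¹ * H).trace := by
  refine Complex.conj_eq_iff_re.1 ?_
  rw [← RCLike.star_def, ← Matrix.trace_conjTranspose, Matrix.conjTranspose_mul,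
    Matrix.conjTranspose_nonsing_inv, hG.eq, hH.eq, Matrix.trace_mul_comm]

lemma trace_inv_mul_eq_mixedDet_div_det (G H : Matrix (Fin 2) (Fin 2) ℂ) :
    (G⁻¹ * H).trace = mixedDet G H / G.det := by
  rw [Matrix.inv_def, Matrix.smul_mul, Matrix.trace_smul, smul_eq_mul, Ring.inverse_eq_inv',
    inv_mul_eq_div, Matrix.adjugate_fin_two, Matrix.trace_fin_two, mixedDet]
  simp only [Matrix.mul_apply, Fin.sum_univ_two, Matrix.of_apply, Matrix.cons_val_zero,
    Matrix.cons_val_one, Matrix.cons_val_fin_one]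
  ring

end LinearAlgebra

section TraceInv

variable {G H : C2 → Matrix (Fin 2) (Fin 2) ℂ} {z : C2} {n : ℕ∞ω}

lemma contDiffAt_det (hG : ∀ i j, ContDiffAt ℝ n (fun w => G w i j) z) :
    ContDiffAt ℝ n (fun w => (G w).det) z := by
  simp only [Matrix.det_fin_two]
  fun_prop

lemma contDiffAt_trace_inv_mul (hG : ∀ i j, ContDiffAt ℝ n (fun w => G w i j) z)
    (hH : ∀ i j, ContDiffAt ℝ n (fun w => H w i j) z) (hdet : (G z).det ≠ 0) :
    ContDiffAt ℝ n (fun w => ((G w)⁻¹ * H w).trace) z := by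
  simp only [trace_inv_mul_eq_mixedDet_div_det, div_eq_mul_inv]
  exact (contDiffAt_mixedDet hG hH).mul ((contDiffAt_det hG).inv hdet)

end TraceInv

section LinearCharts

variable {G : C2 → Matrix (Fin 2) (Fin 2) ℂ} {z : C2}

lemma matrixWirtinger_inFrame (P : Matrix (Fin 2) (Fin 2) ℂ) (k : Fin 2)
    (hG : ∀ i j, DifferentiableAt ℝ (fun w => G w i j) z) :
    matrixWirtinger k (fun w => inFrame P (G w)) z = inFrame P (matrixWirtinger k G z) := by
  ext i j
  simp only [inFrame_apply, matrixWirtinger, Matrix.of_apply, mul_right_comm _ _ (conj (P _ j))]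
  rw [wirtinger_sum _ fun r _ => by fun_prop]
  refine Finset.sum_congr rfl fun r _ => ?_
  rw [wirtinger_sum _ fun s _ => by fun_prop]
  exact Finset.sum_congr rfl fun s _ => wirtinger_const_mul _

lemma matrixWirtingerBar_inFrame (P : Matrix (Fin 2) (Fin 2) ℂ) (k : Fin 2)
    (hG : ∀ i j, DifferentiableAt ℝ (fun w => G w i j) z) :
    matrixWirtingerBar k (fun w => inFrame P (G w)) z = inFrame P (matrixWirtingerBar k G z) := by
  ext i j
  simp only [inFrame_apply, matrixWirtingerBar, Matrix.of_apply,
    mul_right_comm _ _ (conj (P _ j))]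
  rw [wirtingerBar_sum _ fun r _ => by fun_prop]
  refine Finset.sum_congr rfl fun r _ => ?_
  rw [wirtingerBar_sum _ fun s _ => by fun_prop]
  exact Finset.sum_congr rfl fun s _ => wirtingerBar_const_mul _

lemma matrixWirtinger_matrixWirtingerBar_inFrame (P : Matrix (Fin 2) (Fin 2) ℂ) (k l : Fin 2)
    (hG : ∀ i j, ContDiffAt ℝ 2 (fun w => G w i j) z) :
    matrixWirtinger k (matrixWirtingerBar l fun w => inFrame P (G w)) z
      = inFrame P (matrixWirtinger k (matrixWirtingerBar l G) z) := by
  have hbar : matrixWirtingerBar l (fun w => inFrame P (G w)) =ᶠ[𝓝 z]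
      fun w => inFrame P (matrixWirtingerBar l G w) := by
    filter_upwards [eventually_all.2 fun i => eventually_all.2 fun j =>
      (hG i j).eventually (by simp)] with w hw
    exact matrixWirtingerBar_inFrame P l fun i j => (hw i j).differentiableAt two_ne_zero
  have hderiv (i j : Fin 2) : DifferentiableAt ℝ (fun w => matrixWirtingerBar l G w i j) z :=
    (contDiffAt_wirtingerBar (hG i j) one_add_one_eq_two.le).differentiableAt one_ne_zero
  rw [← matrixWirtinger_inFrame P k hderiv]
  ext i j
  exact wirtinger_congr (hbar.fun_comp fun G => G i j)

/-- The automorphism of `ℂ²` with the invertible matrix `P`. -/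
def matrixEquiv (P : (Matrix (Fin 2) (Fin 2) ℂ)ˣ) : C2 ≃L[ℂ] C2 :=
  ContinuousLinearEquiv.unitsEquiv ℂ C2
    (Units.map (Matrix.toEuclideanCLM (n := Fin 2) (𝕜 := ℂ)).toMonoidHom P)

lemma jacobian_matrixEquiv (P : (Matrix (Fin 2) (Fin 2) ℂ)ˣ) (z : C2) :
    jacobian (matrixEquiv P) z = P := by
  ext r i
  rw [jacobian, Matrix.of_apply, ContinuousLinearEquiv.fderiv]
  have happly : matrixEquiv P (dx i)
      = Matrix.toEuclideanCLM (𝕜 := ℂ) P.1 (WithLp.toLp 2 (Pi.single i 1)) := rfl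
  rw [ContinuousLinearEquiv.coe_coe, happly, Matrix.toEuclideanCLM_toLp, Matrix.mulVec_single_one]
  rfl

lemma matrixWirtinger_matrixWirtingerBar_comp_matrixEquiv (P : (Matrix (Fin 2) (Fin 2) ℂ)ˣ)
    (hG : ∀ i j, ContDiffAt ℝ 2 (fun w => G w i j) (matrixEquiv P z)) (i j k l : Fin 2) :
    matrixWirtinger k (matrixWirtingerBar l fun w => G (matrixEquiv P w)) z i j
      = inFrame P (.of fun r s =>
          matrixWirtinger r (matrixWirtingerBar s G) (matrixEquiv P z) i j) k l := by
  have h := wirtinger_wirtingerBar_comp (i := k) (j := l) (z := z)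
    (matrixEquiv P).contDiff.contDiffAt (hG i j)
  rwa [jacobian_matrixEquiv] at h

variable {M : Type*} [TopologicalSpace M] {e : OpenPartialHomeomorph M C2}
  {P : (Matrix (Fin 2) (Fin 2) ℂ)ˣ}

/-- The chart obtained from `e` by the linear change of coordinates with matrix `P`: its coordinate
vectors are the combinations of those of `e` with the columns of `P` as coefficients. -/
def linearChart (e : OpenPartialHomeomorph M C2) (P : (Matrix (Fin 2) (Fin 2) ℂ)ˣ) :
    OpenPartialHomeomorph M C2 :=
  e.transHomeomorph (matrixEquiv P).symm.toHomeomorph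

lemma matrixEquiv_linearChart (p : M) : matrixEquiv P (linearChart e P p) = e p :=
  (matrixEquiv P).apply_symm_apply (e p)

lemma eventuallyEq_linearChart (hz : z ∈ (linearChart e P).target) :
    e ∘ (linearChart e P).symm =ᶠ[𝓝 z] matrixEquiv P := by
  filter_upwards [(linearChart e P).open_target.mem_nhds hz] with w hw using e.right_inv hw

lemma jacobian_linearChart (hz : z ∈ (linearChart e P).target) :
    jacobian (e ∘ (linearChart e P).symm) z = P := by
  rw [← jacobian_matrixEquiv P z, jacobian, (eventuallyEq_linearChart hz).fderiv_eq, jacobian]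

variable [ChartedSpace C2 M] [IsManifold 𝓘(ℂ, C2) ω M]

lemma linearChart_mem (he : e ∈ holomorphicAtlas M)
    (P : (Matrix (Fin 2) (Fin 2) ℂ)ˣ) : linearChart e P ∈ holomorphicAtlas M :=
  OpenPartialHomeomorph.mem_maximalAtlas_of_contMDiffOn _
    ((matrixEquiv P).symm.contDiff.contMDiff.comp_contMDiffOn (contMDiffOn_of_mem_maximalAtlas he))
    ((contMDiffOn_symm_of_mem_maximalAtlas he).comp (matrixEquiv P).contDiff.contMDiff.contMDiffOn
      fun _ hx => hx)

lemma complexHessian_linearChart (he : e ∈ holomorphicAtlas M)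
    {u : M → ℝ} {p : M} (hp : p ∈ e.source) (hu : ContDiffAt ℝ 2 (u ∘ e.symm) (e p)) :
    complexHessian (u ∘ (linearChart e P).symm) (linearChart e P p)
      = inFrame P (complexHessian (u ∘ e.symm) (e p)) := by
  have hinv : (linearChart e P).symm (linearChart e P p) = p := (linearChart e P).left_inv hp
  have hz := (linearChart e P).map_source hp
  rw [complexHessian_transition he (linearChart_mem he P) hz (by rwa [hinv]) (by rwa [hinv]),
    jacobian_linearChart hz, hinv]

lemma KahlerMetric.coordMatrix_linearChart (g : KahlerMetric M)
    (he : e ∈ holomorphicAtlas M) (hz : z ∈ (linearChart e P).target) :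
    coordMatrix g.inner (linearChart e P) z
      = inFrame P (coordMatrix g.inner e (matrixEquiv P z)) := by
  have htransition : e ((linearChart e P).symm z) = matrixEquiv P z := e.right_inv hz
  rw [g.coordMatrix_transition he (linearChart_mem he P) hz (e.map_target hz),
    jacobian_linearChart hz, htransition]

lemma KahlerMetric.secondDeriv_coordMatrix_linearChart
    (g : KahlerMetric M) (he : e ∈ holomorphicAtlas M) {p : M} (hp : p ∈ e.source)
    (i j k l : Fin 2) :
    matrixWirtinger k (matrixWirtingerBar l (coordMatrix g.inner (linearChart e P)))
        (linearChart e P p) i j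
      = inFrame P (.of fun r s => inFrame P (matrixWirtinger r (matrixWirtingerBar s
          (coordMatrix g.inner e)) (e p)) i j) k l := by
  have hG (r s : Fin 2) : ContDiffAt ℝ 2 (fun w => coordMatrix g.inner e w r s) (e p) :=
    (g.contDiffAt_coordMatrix he (e.map_source hp) r s).of_le (by norm_cast)
  have hframe (r s : Fin 2) : ContDiffAt ℝ 2
      (fun w => inFrame P (coordMatrix g.inner e w) r s) (e p) := by
    simp only [inFrame_apply]
    fun_prop
  have hchart : coordMatrix g.inner (linearChart e P) =ᶠ[𝓝 (linearChart e P p)]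
      fun w => inFrame P (coordMatrix g.inner e (matrixEquiv P w)) := by
    filter_upwards [(linearChart e P).open_target.mem_nhds ((linearChart e P).map_source hp)]
      with w hw using g.coordMatrix_linearChart he hw
  have hbar := eventuallyEq_wirtingerBar (i := l) (hchart.fun_comp fun G => G i j)
  rw [← matrixEquiv_linearChart (e := e) (P := P) p] at hG hframe ⊢
  have hcomp := matrixWirtinger_matrixWirtingerBar_comp_matrixEquiv P hframe i j k l
  refine (wirtinger_congr hbar).trans (hcomp.trans ?_)
  simp only [matrixWirtinger_matrixWirtingerBar_inFrame _ _ _ hG]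

end LinearCharts

section CurvatureBound

lemma norm_inFrame_apply_le {m n : Type*} [Fintype m] {P : Matrix m n ℂ} {κ : ℝ}
    (hP : ∀ r i, ‖P r i‖ ^ 2 ≤ κ) (G : Matrix m m ℂ) (i j : n) :
    ‖inFrame P G i j‖ ≤ κ * ∑ r, ∑ s, ‖G r s‖ := by
  simp only [inFrame_apply, Finset.mul_sum]
  refine norm_sum_le_of_le _ fun r _ => norm_sum_le_of_le _ fun s _ => ?_
  calc ‖P r i * G r s * conj (P s j)‖ = ‖P r i‖ * ‖P s j‖ * ‖G r s‖ := by
        rw [norm_mul, norm_mul, Complex.norm_conj, mul_right_comm]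
    _ ≤ κ * ‖G r s‖ := by
        have hmul : ‖P r i‖ * ‖P s j‖ ≤ κ := by
          linarith [two_mul_le_add_sq ‖P r i‖ ‖P s j‖, hP r i, hP s j]
        gcongr

variable {M : Type*} [TopologicalSpace M] [ChartedSpace C2 M] [IsManifold 𝓘(ℂ, C2) ω M]
  {e : OpenPartialHomeomorph M C2} {z : C2} {p : M}

/-- A bound, continuous along the chart `e`, for the second derivatives `∂_k ∂_l̄ g_{i j̄}` in all
coordinate systems obtained from `e` by a linear change that makes `(g_{i j̄})` the identity at the
point with coordinates `z`. -/
def KahlerMetric.secondDerivBound (g : KahlerMetric M) (e : OpenPartialHomeomorph M C2) (z : C2) :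
    ℝ :=
  (coordMatrix g.inner e z)⁻¹.trace.re * ∑ k, ∑ l, (coordMatrix g.inner e z)⁻¹.trace.re *
    ∑ i, ∑ j, ‖matrixWirtinger k (matrixWirtingerBar l (coordMatrix g.inner e)) z i j‖

lemma KahlerMetric.continuousAt_secondDerivBound (g : KahlerMetric M)
    (he : e ∈ holomorphicAtlas M) (hz : z ∈ e.target) :
    ContinuousAt (g.secondDerivBound e) z := by
  have hG (i j : Fin 2) : ContDiffAt ℝ 2 (fun w => coordMatrix g.inner e w i j) z :=
    (g.contDiffAt_coordMatrix he hz i j).of_le (by norm_cast)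
  have htrace : ContinuousAt (fun w => (coordMatrix g.inner e w)⁻¹.trace.re) z := by
    have htrace := (contDiffAt_trace_inv_mul hG (H := 1) (fun _ _ => contDiffAt_const)
      (g.det_coordMatrix_ne_zero he hz)).continuousAt
    simp only [Pi.one_apply, mul_one] at htrace
    exact Complex.continuous_re.continuousAt.comp htrace
  have hderiv (k l i j : Fin 2) : ContinuousAt
      (fun w => matrixWirtinger k (matrixWirtingerBar l (coordMatrix g.inner e)) w i j) z :=
    (contDiffAt_wirtinger (m := 0) (contDiffAt_wirtingerBar (hG i j) one_add_one_eq_two.le)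
      (zero_add 1).le).continuousAt
  unfold secondDerivBound
  fun_prop

lemma KahlerMetric.norm_secondDeriv_linearChart_le (g : KahlerMetric M)
    (he : e ∈ holomorphicAtlas M) (hp : p ∈ e.source) {P : (Matrix (Fin 2) (Fin 2) ℂ)ˣ}
    (hP : inFrame P.1 (coordMatrix g.inner e (e p)) = 1) (i j k l : Fin 2) :
    ‖matrixWirtinger k (matrixWirtingerBar l (coordMatrix g.inner (linearChart e P)))
      (linearChart e P p) i j‖ ≤ g.secondDerivBound e (e p) := by
  have hframe := norm_inFrame_apply_le (sq_norm_le_re_trace_inv hP)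
  have hκ := (sq_nonneg _).trans (sq_norm_le_re_trace_inv hP 0 0)
  rw [g.secondDeriv_coordMatrix_linearChart he hp, secondDerivBound]
  refine (hframe _ k l).trans ?_
  gcongr with r _ s _
  exact hframe _ i j

lemma KahlerMetric.exists_adapted_chart (g : KahlerMetric M) {φ : M → ℝ}
    (he : e ∈ holomorphicAtlas M) (hp : p ∈ e.source) (hφ : ContDiffAt ℝ 2 (φ ∘ e.symm) (e p))
    (hadm : g.IsAdmissible φ) :
    ∃ e' ∈ holomorphicAtlas M, p ∈ e'.source ∧ coordMatrix g.inner e' (e' p) = 1 ∧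
      (∃ a b : ℝ, 0 < a ∧ 0 < b ∧
        coordMatrix g.inner e' (e' p) + complexHessian (φ ∘ e'.symm) (e' p)
          = Matrix.diagonal ![(a : ℂ), (b : ℂ)]) ∧
      ∀ i j k l, ‖matrixWirtinger k (matrixWirtingerBar l (coordMatrix g.inner e')) (e' p) i j‖
        ≤ g.secondDerivBound e (e p) := by
  obtain ⟨P, d, hd, hPG, hPH⟩ := exists_inFrame_eq_one_and_eq_diagonal
    (g.posDef_coordMatrix he (e.map_source hp)) (hadm e he p hp)
  have hunit : IsUnit P := by
    rw [inFrame, Matrix.mul_assoc] at hPG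
    exact (Matrix.isUnit_transpose P).1 (IsUnit.of_mul_eq_one _ hPG)
  lift P to (Matrix (Fin 2) (Fin 2) ℂ)ˣ using hunit
  have hG : coordMatrix g.inner (linearChart e P) (linearChart e P p)
      = inFrame P (coordMatrix g.inner e (e p)) := by
    rw [g.coordMatrix_linearChart he ((linearChart e P).map_source hp), matrixEquiv_linearChart]
  refine ⟨linearChart e P, linearChart_mem he P, hp, hG.trans hPG,
    ⟨d 0, d 1, hd 0, hd 1, ?_⟩, g.norm_secondDeriv_linearChart_le he hp hPG⟩
  have hdiag : (fun i => (d i : ℂ)) = ![(d 0 : ℂ), (d 1 : ℂ)] := by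
    ext i
    fin_cases i <;> rfl
  rw [hG, complexHessian_linearChart he hp hφ, ← inFrame_add, ← hdiag]
  exact hPH

lemma exists_forall_exists_chart_le [CompactSpace M] {F : OpenPartialHomeomorph M C2 → C2 → ℝ}
    (hF : ∀ e ∈ holomorphicAtlas M, ∀ z ∈ e.target, ContinuousAt (F e) z) :
    ∃ C, ∀ p, ∃ e ∈ holomorphicAtlas M, p ∈ e.source ∧ F e (e p) ≤ C := by
  have hnhds (q : M) : {p | p ∈ (chartAt C2 q).source ∧
      F (chartAt C2 q) (chartAt C2 q p) ≤ F (chartAt C2 q) (chartAt C2 q q) + 1} ∈ 𝓝 q := by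
    have hq := mem_chart_source C2 q
    have hcont := (hF _ (IsManifold.chart_mem_maximalAtlas q) _
      ((chartAt C2 q).map_source hq)).comp ((chartAt C2 q).continuousAt hq)
    filter_upwards [(chartAt C2 q).open_source.mem_nhds hq,
      hcont.eventually (ge_mem_nhds (lt_add_one _))] with p hp hle using ⟨hp, hle⟩
  obtain ⟨t, ht⟩ := CompactSpace.elim_nhds_subcover _ hnhds
  obtain ⟨C, hC⟩ := (t.image fun q => F (chartAt C2 q) (chartAt C2 q q) + 1).exists_le
  refine ⟨C, fun p => ?_⟩
  obtain ⟨q, hq, hp, hle⟩ := Set.mem_iUnion₂.1 (ht.ge (Set.mem_univ p))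
  exact ⟨chartAt C2 q, IsManifold.chart_mem_maximalAtlas q, hp,
    hle.trans (hC _ (Finset.mem_image_of_mem _ hq))⟩

end CurvatureBound

section GlobalEstimate

lemma le_mul_exp_of_log_sub_le {x y a b : ℝ} (hx : 0 < x) (hy : 0 < y)
    (h : Real.log x - a ≤ Real.log y - b) : x ≤ y * Real.exp (a - b) := by
  rw [← Real.exp_log hx, ← Real.exp_log hy, ← Real.exp_add, Real.exp_le_exp]
  linarith

lemma le_add_add_one_of_sq_le {t α β : ℝ} (hα : 0 ≤ α) (hβ : 0 ≤ β) (h : t ^ 2 ≤ α + β * t) :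
    t ≤ α + β + 1 := by
  nlinarith

variable {M : Type*} [TopologicalSpace M] [ChartedSpace C2 M] [IsManifold 𝓘(ℂ, C2) ω M]
  {g : KahlerMetric M} {f φ : M → ℝ} {e : OpenPartialHomeomorph M C2} {z : C2} {p : M}

namespace KahlerMetric

lemma ofReal_laplacian (g : KahlerMetric M) (he : e ∈ holomorphicAtlas M) (hz : z ∈ e.target)
    (hφ : ContDiffAt ℝ 2 (φ ∘ e.symm) z) :
    (g.laplacian φ (e.symm z) : ℂ)
      = ((coordMatrix g.inner e z)⁻¹ * complexHessian (φ ∘ e.symm) z).trace := by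
  rw [g.laplacian_eq he hz hφ, ofReal_re_trace_inv_mul (g.posDef_coordMatrix he hz).isHermitian
    (isHermitian_complexHessian hφ)]

lemma two_add_laplacian_mul_det (g : KahlerMetric M) (he : e ∈ holomorphicAtlas M)
    (hz : z ∈ e.target) (hφ : ContDiffAt ℝ 2 (φ ∘ e.symm) z) :
    ((2 + g.laplacian φ (e.symm z) : ℝ) : ℂ) * (coordMatrix g.inner e z).det
      = mixedDet (coordMatrix g.inner e z)
        (coordMatrix g.inner e z + complexHessian (φ ∘ e.symm) z) := by
  have hdet := g.det_coordMatrix_ne_zero he hz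
  rw [← eq_div_iff hdet, ← trace_inv_mul_eq_mixedDet_div_det, Matrix.mul_add,
    Matrix.nonsing_inv_mul _ hdet.isUnit, Matrix.trace_add, Matrix.trace_one,
    Complex.ofReal_add, g.ofReal_laplacian he hz hφ]
  rfl

lemma contDiffAt_laplacian (g : KahlerMetric M) (he : e ∈ holomorphicAtlas M)
    (hz : z ∈ e.target) (hφ : ContMDiff 𝓘(ℝ, C2) 𝓘(ℝ, ℝ) 4 φ) :
    ContDiffAt ℝ 2 (g.laplacian φ ∘ e.symm) z := by
  have hφ₄ {w : C2} (hw : w ∈ e.target) : ContDiffAt ℝ 4 (φ ∘ e.symm) w :=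
    contDiffAt_comp_symm (n := 4) hφ he hw
  have htrace := contDiffAt_trace_inv_mul (g.isKahlerAt_coordMatrix he hz).contDiffAt
    (isKahlerAt_complexHessian (hφ₄ hz)).contDiffAt (g.det_coordMatrix_ne_zero he hz)
  refine (Complex.reCLM.contDiff.contDiffAt.comp z htrace).congr_of_eventuallyEq ?_
  filter_upwards [e.open_target.mem_nhds hz] with w hw
  exact g.laplacian_eq he hw ((hφ₄ hw).of_le (by norm_num))

lemma continuous_laplacian (g : KahlerMetric M) (hφ : ContMDiff 𝓘(ℝ, C2) 𝓘(ℝ, ℝ) 4 φ) :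
    Continuous (g.laplacian φ) := by
  refine continuous_iff_continuousAt.2 fun p => ?_
  have hp := mem_chart_source C2 p
  rw [(chartAt C2 p).symm.continuousAt_iff_continuousAt_comp_right hp]
  exact (g.contDiffAt_laplacian (IsManifold.chart_mem_maximalAtlas p)
    ((chartAt C2 p).map_source hp) hφ).continuousAt

namespace SolvesMongeAmpere

lemma mul_det_eq (hMA : g.SolvesMongeAmpere f φ) (he : e ∈ holomorphicAtlas M)
    (hz : z ∈ e.target) :
    (f (e.symm z) : ℂ) * (coordMatrix g.inner e z).det
      = (coordMatrix g.inner e z + complexHessian (φ ∘ e.symm) z).det := by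
  simpa only [matrix, hessianMatrix, e.right_inv hz] using
    (hMA e he (e.symm z) (e.map_target hz)).symm

lemma pos (hMA : g.SolvesMongeAmpere f φ) (hadm : g.IsAdmissible φ) (p : M) : 0 < f p := by
  have hp := mem_chart_source C2 p
  have he : chartAt C2 p ∈ holomorphicAtlas M := IsManifold.chart_mem_maximalAtlas p
  have hdet := (hadm _ he p hp).det_pos
  rw [hMA _ he p hp] at hdet
  exact_mod_cast (mul_pos_iff_of_pos_right
    (g.posDef_coordMatrix he ((chartAt C2 p).map_source hp)).det_pos).1 hdet

lemma contDiffAt (hMA : g.SolvesMongeAmpere f φ) (hφ : ContMDiff 𝓘(ℝ, C2) 𝓘(ℝ, ℝ) 4 φ)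
    (he : e ∈ holomorphicAtlas M) (hz : z ∈ e.target) : ContDiffAt ℝ 2 (f ∘ e.symm) z := by
  have hG := g.isKahlerAt_coordMatrix he hz
  have hH := hG.add (isKahlerAt_complexHessian (contDiffAt_comp_symm (n := 4) hφ he hz))
  have hquot := (contDiffAt_det hH.contDiffAt).mul
    ((contDiffAt_det hG.contDiffAt).inv (g.det_coordMatrix_ne_zero he hz))
  refine (Complex.reCLM.contDiff.contDiffAt.comp z hquot).congr_of_eventuallyEq ?_
  filter_upwards [e.open_target.mem_nhds hz] with w hw
  rw [Function.comp_apply, Function.comp_apply, ← hMA.mul_det_eq he hw, Pi.inv_apply,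
    mul_inv_cancel_right₀ (g.det_coordMatrix_ne_zero he hw), Complex.reCLM_apply,
    Complex.ofReal_re]

end SolvesMongeAmpere

lemma two_add_laplacian_eq_add (g : KahlerMetric M) (he : e ∈ holomorphicAtlas M)
    (hp : p ∈ e.source) (hφ : ContDiffAt ℝ 2 (φ ∘ e.symm) (e p)) {a b : ℝ}
    (hG : coordMatrix g.inner e (e p) = 1)
    (hH : coordMatrix g.inner e (e p) + complexHessian (φ ∘ e.symm) (e p)
      = Matrix.diagonal ![(a : ℂ), (b : ℂ)]) : 2 + g.laplacian φ p = a + b := by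
  have h := g.two_add_laplacian_mul_det he (e.map_source hp) hφ
  rw [hH, hG, e.left_inv hp, mixedDet_one_left, Matrix.det_one, mul_one,
    Matrix.trace_diagonal, Fin.sum_univ_two] at h
  exact Complex.ofReal_injective (h.trans (Complex.ofReal_add a b).symm)

lemma two_add_laplacian_pos (g : KahlerMetric M) (hφ : ContMDiff 𝓘(ℝ, C2) 𝓘(ℝ, ℝ) 4 φ)
    (hadm : g.IsAdmissible φ) (p : M) : 0 < 2 + g.laplacian φ p := by
  have hφ₂ {e : OpenPartialHomeomorph M C2} (he : e ∈ holomorphicAtlas M) (hp : p ∈ e.source) :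
      ContDiffAt ℝ 2 (φ ∘ e.symm) (e p) :=
    (contDiffAt_comp_symm (n := 4) hφ he (e.map_source hp)).of_le (by norm_num)
  have hc : chartAt C2 p ∈ holomorphicAtlas M := IsManifold.chart_mem_maximalAtlas p
  have hp := mem_chart_source C2 p
  obtain ⟨e, he, hpe, hG, ⟨a, b, ha, hb, hH⟩, -⟩ :=
    g.exists_adapted_chart hc hp (hφ₂ hc hp) hadm
  rw [g.two_add_laplacian_eq_add he hpe (hφ₂ he hpe) hG hH]
  exact add_pos ha hb

lemma sq_two_add_laplacian_le_of_adapted {L : ℝ≥0} {A C lam a b : ℝ}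
    (hφ : ContMDiff 𝓘(ℝ, C2) 𝓘(ℝ, ℝ) 4 φ) (hMA : g.SolvesMongeAmpere f φ)
    (hf : ∀ p, 0 < f p) (hA : -A ≤ g.laplacian f p) (hL : g.IsLipschitz L fun p => √(f p))
    (hmax : IsLocalMax (fun q => Real.log (2 + g.laplacian φ q) - lam * φ q) p)
    (he : e ∈ holomorphicAtlas M) (hp : p ∈ e.source) (hG : coordMatrix g.inner e (e p) = 1)
    (ha : 0 < a) (hb : 0 < b) (hH : coordMatrix g.inner e (e p)
      + complexHessian (φ ∘ e.symm) (e p) = Matrix.diagonal ![(a : ℂ), (b : ℂ)])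
    (hC : ‖matrixWirtinger 1 (matrixWirtingerBar 1 (coordMatrix g.inner e)) (e p) 0 0‖ ≤ C) :
    (lam - C) * (2 + g.laplacian φ p) ^ 2
      ≤ A + 8 * L ^ 2 + 2 * lam * f p * (2 + g.laplacian φ p) := by
  have hz := e.map_source hp
  have hinv := e.left_inv hp
  have hφ₄ : ContDiffAt ℝ 4 (φ ∘ e.symm) (e p) := contDiffAt_comp_symm (n := 4) hφ he hz
  have hφ₂ : ∀ w ∈ e.target, ContDiffAt ℝ 2 (φ ∘ e.symm) w := fun w hw =>
    (contDiffAt_comp_symm (n := 4) hφ he hw).of_le (by norm_num)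
  have hfz := hMA.contDiffAt hφ he hz
  have hfab : f p = a * b := by
    have h := hMA.mul_det_eq he hz
    rw [hH, hG, hinv, Matrix.det_one, mul_one, Matrix.det_diagonal, Fin.prod_univ_two] at h
    exact Complex.ofReal_injective (h.trans (Complex.ofReal_mul a b).symm)
  have hlap : -A ≤ ∑ k, (complexHessian (f ∘ e.symm) (e p) k k).re := by
    rwa [← hinv, g.laplacian_eq he hz hfz, hG, inv_one, Matrix.one_mul, Matrix.trace,
      Complex.re_sum] at hA
  have hgrad : ∑ k, Complex.normSq (wirtinger k (fun w => ((f ∘ e.symm) w : ℂ)) (e p))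
      ≤ 8 * L ^ 2 * (f ∘ e.symm) (e p) := by
    have htrace : (coordMatrix g.inner e (e p)).trace.re = 2 := by
      rw [hG, Matrix.trace_one]
      rfl
    have h := hL.sum_normSq_wirtinger_le he hz (hfz.differentiableAt two_ne_zero) (hf _)
    rw [htrace] at h
    linarith
  have hlocal := (hinv.symm ▸ hmax :).comp_continuous (e.continuousAt_symm hz)
  have hnear := e.open_target.mem_nhds hz
  have hestimate := (g.isKahlerAt_coordMatrix he hz).sq_trace_le_of_isLocalMax
    ((g.isKahlerAt_coordMatrix he hz).add (isKahlerAt_complexHessian hφ₄)) hG hH ha hb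
    (contDiffAt_const.add (g.contDiffAt_laplacian he hz hφ)) hfz (hφ₂ _ hz)
    (by filter_upwards [hnear] with w hw using g.two_add_laplacian_mul_det he hw (hφ₂ w hw))
    (by filter_upwards [hnear] with w hw using hMA.mul_det_eq he hw)
    (add_sub_cancel_left _ _).symm hlocal hlap hgrad
    ((Complex.re_le_norm _).trans hC) ((norm_nonneg _).trans hC)
  rwa [← hfab, ← g.two_add_laplacian_eq_add he hp (hφ₂ _ hz) hG hH] at hestimate

lemma sq_two_add_laplacian_le_of_isLocalMax {L : ℝ≥0} {A lam : ℝ}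
    (hφ : ContMDiff 𝓘(ℝ, C2) 𝓘(ℝ, ℝ) 4 φ) (hMA : g.SolvesMongeAmpere f φ)
    (hadm : g.IsAdmissible φ) (hA : -A ≤ g.laplacian f p)
    (hL : g.IsLipschitz L fun p => √(f p)) (he : e ∈ holomorphicAtlas M) (hp : p ∈ e.source)
    (hmax : IsLocalMax (fun q => Real.log (2 + g.laplacian φ q) - lam * φ q) p) :
    (lam - g.secondDerivBound e (e p)) * (2 + g.laplacian φ p) ^ 2
      ≤ A + 8 * L ^ 2 + 2 * lam * f p * (2 + g.laplacian φ p) := by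
  have hφz : ContDiffAt ℝ 4 (φ ∘ e.symm) (e p) :=
    contDiffAt_comp_symm (n := 4) hφ he (e.map_source hp)
  obtain ⟨e', he', hp', hG, ⟨a, b, ha, hb, hH⟩, hC⟩ :=
    g.exists_adapted_chart he hp (hφz.of_le (by norm_num)) hadm
  exact sq_two_add_laplacian_le_of_adapted hφ hMA (hMA.pos hadm) hA hL hmax he' hp' hG ha hb hH
    (hC 0 0 1 1)

lemma two_add_laplacian_le_of_isLocalMax {L : ℝ≥0} {A S lam : ℝ}
    (hφ : ContMDiff 𝓘(ℝ, C2) 𝓘(ℝ, ℝ) 4 φ) (hMA : g.SolvesMongeAmpere f φ)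
    (hadm : g.IsAdmissible φ) (hA : -A ≤ g.laplacian f p) (hS : f p ≤ S)
    (hL : g.IsLipschitz L fun p => √(f p)) (he : e ∈ holomorphicAtlas M) (hp : p ∈ e.source)
    (hlam : 0 ≤ lam) (hbound : g.secondDerivBound e (e p) + 1 ≤ lam)
    (hmax : IsLocalMax (fun q => Real.log (2 + g.laplacian φ q) - lam * φ q) p) :
    2 + g.laplacian φ p ≤ |A| + 8 * L ^ 2 + 2 * lam * |S| + 1 := by
  have hT := (g.two_add_laplacian_pos hφ hadm p).le
  have hquad := sq_two_add_laplacian_le_of_isLocalMax hφ hMA hadm hA hL he hp hmax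
  generalize 2 + g.laplacian φ p = T at hT hquad ⊢
  refine le_add_add_one_of_sq_le (by positivity) (by positivity) ?_
  calc T ^ 2 ≤ (lam - g.secondDerivBound e (e p)) * T ^ 2 :=
        le_mul_of_one_le_left (sq_nonneg T) (by linarith)
    _ ≤ A + 8 * L ^ 2 + 2 * lam * f p * T := hquad
    _ ≤ |A| + 8 * L ^ 2 + 2 * lam * |S| * T := by
        gcongr
        exacts [le_abs_self A, hS.trans (le_abs_self S)]

lemma exists_forall_log_two_add_laplacian_sub_le [CompactSpace M] [Nonempty M] (g : KahlerMetric M)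
    (hφ : ContMDiff 𝓘(ℝ, C2) 𝓘(ℝ, ℝ) 4 φ) (hadm : g.IsAdmissible φ) (lam : ℝ) :
    ∃ p, ∀ q, Real.log (2 + g.laplacian φ q) - lam * φ q
      ≤ Real.log (2 + g.laplacian φ p) - lam * φ p := by
  have hcont : Continuous fun q => Real.log (2 + g.laplacian φ q) - lam * φ q :=
    ((continuous_const.add (g.continuous_laplacian hφ)).log fun q =>
      (g.two_add_laplacian_pos hφ hadm q).ne').sub (continuous_const.mul hφ.continuous)
  obtain ⟨p, -, hp⟩ := isCompact_univ.exists_isMaxOn Set.univ_nonempty hcont.continuousOn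
  exact ⟨p, fun q => hp (Set.mem_univ q)⟩

end KahlerMetric

end GlobalEstimate

end KahlerSurface

end

theorem mainTheorem5_general (M : Type*) [TopologicalSpace M] [CompactSpace M]
    [ChartedSpace C2 M] [IsManifold 𝓘(ℂ, C2) ω M] (g : KahlerMetric M)
    (oscBound A supBound : ℝ) (L : ℝ≥0) :
    ∃ C : ℝ, ∀ f φ : M → ℝ,
      (∀ p, f p ≤ supBound) →
      (∀ p, -A ≤ g.laplacian f p) →
      g.IsLipschitz L (fun p => f p ^ (1 / 2 : ℝ)) →
      ContMDiff 𝓘(ℝ, C2) 𝓘(ℝ, ℝ) 4 φ →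
      g.SolvesMongeAmpere f φ →
      g.IsAdmissible φ →
      (∀ p q, φ p - φ q ≤ oscBound) →
      ∀ p, |g.laplacian φ p| ≤ C := by
  obtain ⟨K, hK⟩ := exists_forall_exists_chart_le fun _ he _ hz =>
    g.continuousAt_secondDerivBound he hz
  set lam := |K| + 1
  set τ := |A| + 8 * L ^ 2 + 2 * lam * |supBound| + 1
  refine ⟨τ * Real.exp (lam * oscBound) + 2, fun f φ hsup hA hL hφ hMA hadm hosc q => ?_⟩
  simp only [← Real.sqrt_eq_rpow] at hL
  have hpos := g.two_add_laplacian_pos hφ hadm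
  have : Nonempty M := ⟨q⟩
  obtain ⟨p, hmax⟩ := g.exists_forall_log_two_add_laplacian_sub_le hφ hadm lam
  obtain ⟨e, he, hp, hKp⟩ := hK p
  have hTp : 2 + g.laplacian φ p ≤ τ :=
    KahlerMetric.two_add_laplacian_le_of_isLocalMax hφ hMA hadm (hA p) (hsup p) hL he hp
      (by positivity) (by linarith [le_abs_self K]) (.of_forall hmax)
  have hTq : 2 + g.laplacian φ q ≤ τ * Real.exp (lam * oscBound) := calc
    2 + g.laplacian φ q ≤ (2 + g.laplacian φ p) * Real.exp (lam * φ q - lam * φ p) :=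
      le_mul_exp_of_log_sub_le (hpos q) (hpos p) (hmax q)
    _ ≤ τ * Real.exp (lam * oscBound) := by
      rw [← mul_sub]
      gcongr
      exact hosc q p
  exact abs_le.2 ⟨by linarith [hpos q], by linarith⟩

theorem mainTheorem5 (M : Type*) [TopologicalSpace M] [T2Space M] [CompactSpace M]
    [ChartedSpace C2 M] [IsManifold 𝓘(ℂ, C2) ω M] (g : KahlerMetric M)
    (oscBound A supBound : ℝ) (L : ℝ≥0) :
    ∃ C : ℝ, ∀ f φ : M → ℝ,
      (∀ p, 0 < f p) →
      (∀ p, f p ≤ supBound) →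
      (∀ p, -A ≤ g.laplacian f p) →
      g.IsLipschitz L (fun p => f p ^ (1 / 2 : ℝ)) →
      ContMDiff 𝓘(ℝ, C2) 𝓘(ℝ, ℝ) 4 φ →
      g.SolvesMongeAmpere f φ →
      g.IsAdmissible φ →
      (∀ p q, φ p - φ q ≤ oscBound) →
      ∀ p, |g.laplacian φ p| ≤ C := by
  obtain ⟨C, hC⟩ := mainTheorem5_general M g oscBound A supBound L
  exact ⟨C, fun f φ _ => hC f φ⟩
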